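/- Theorem. Setting. Gabor transform and Hermite functions. Let $g(t)=2^{1/4}e^{-\pi t^2}$. For a tempered distribution $T$ on $\mathbb R$ put $V_gT(u,v)=\langle T, M_vT_ug\rangle$, where $M_vT_ug(t)=e^{2\pi i v t}g(t-u)$ and $\langle\cdot,\cdot\rangle$ extends the $L^2(\mathbb R)$ inner product $\langle f,h\rangle=\int f\overline h$. For $k\ge 0$ let $$h_k(x)=\frac{(-1)^k}{\sqrt{2^{2k-1/2}\pi^k k!}}\,e^{\pi x^2}\frac{d^k}{dx^k}e^{-2\pi x^2}$$ be the $L^2$-normalised Hermite functions. White noise. $\xi$ is (real, unit) Gaussian white noise, i.e. a random tempered distribution that is real on real Schwartz functions, with $\mathbb E\,e^{i\langle\xi,\varphi\rangle}=e^{-\|\varphi\|_{L^2}^2/2}$ for all real Schwartz $\varphi$. Observation. For $\lambda\in\mathbb R$, $0<\sigma\le\sqrt\pi$ and $k\ge1$ let $y=\lambda h_k+\sigma\xi$, with law denoted $\mathbb P_k$. ($\sigma=1$ is unit white noise; $\sigma=\sqrt\pi$ is noise whose Gabor transform has pointwise variance $\pi$.) For $L>0$ let $\Lambda(\theta)=\{(u,v)\in\mathbb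 R^2: \max(|u|,|v|)\le L,\ |V_gy(u,v)|\ge\theta\}$. Statistics. Let $\hat\theta=\max\{\theta\ge0:\Lambda(\theta)\ne\emptyset\}$, let $\hat k$ be the integer nearest to $\pi\,(\min\{\sqrt{u^2+v^2}:(u,v)\in\Lambda(\hat\theta)\})^2$, and let $\hat\lambda=\hat\theta\big/\prod_{t=1}^{\hat k}\sqrt{\hat k/(et)}$. Constants. Let $C(k,r)=(1+r)^k e^{-k(r+r^2/2)}$, $\beta(k)=\max\{C(k,\tfrac1{4k+2}),C(k,-\tfrac1{4k+2})\}$, $C(k_0)=\dfrac{2}{5(1-\max_{1\le k\le k_0}\beta(k))}+1$ and $\mathfrak M(k_0)=\min_{1\le k\le k_0}\max_{u,v\in\mathbb R}|V_gh_k(u,v)|$. Claim. There is an absolute constant $K>0$ with the following two properties. (i) For all $L\ge\pi$ and $\tau>0$, $$\mathbb P\Big[\sup_{\max(|u|,|v|)\le L}\sqrt\pi\,|V_g\xi(u,v)|\le\sqrt2\,(14K+\tau)\sqrt{\log L}\Big]\ge1-4\exp\Big(-\frac{\tau^2}{2\pi}\log L\Big).$$ (ii) For all $k_0\ge1$, $0<\delta\le1$,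 $0<\sigma\le\sqrt\pi$, all $L>\max\{\sqrt{k_0/\pi},\ \pi,\ \exp((14K/\delta)^2)\}$ and all real $\lambda$ with $|\lambda|\ge5\,C(k_0)\sqrt2\,\mathfrak M(k_0)^{-1}\log L$, $$\inf_{1\le k\le k_0}\mathbb P_k\Big[\Big|\frac{\hat\lambda}{|\lambda|}-1\Big|\le\delta\Big]\ \ge\ 1-4\exp\Big(-\frac{\delta^2\log^2L}{2\pi}\Big(1-\frac{14K}{\delta\sqrt{\log L}}\Big)^2\Big).$$ -/

import Mathlib

open MeasureTheory SchwartzMap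

noncomputable section

namespace Gabor

/-! Polynomials times the Gaussian `exp (-π x²)` are Schwartz functions. -/

theorem polyGauss_bound (p : Polynomial ℝ) :
    ∃ C : ℝ, ∀ x : ℝ, |p.eval x * Real.exp (-Real.pi * x ^ 2)| ≤ C := by
  induction p using Polynomial.induction_on' with
  | add p q hp hq =>
    obtain ⟨C, hC⟩ := hp
    obtain ⟨D, hD⟩ := hq
    refine ⟨C + D, fun x => ?_⟩
    rw [Polynomial.eval_add, add_mul]
    exact (abs_add_le _ _).trans (add_le_add (hC x) (hD x))
  | monomial n a =>
    refine ⟨|a| * (1 + n.factorial), fun x => ?_⟩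
    rw [Polynomial.eval_monomial, abs_mul, abs_mul, mul_assoc, Real.abs_exp]
    refine mul_le_mul_of_nonneg_left ?_ (abs_nonneg a)
    have h1 : Real.exp (-Real.pi * x ^ 2) ≤ Real.exp (-(x ^ 2)) := by
      apply Real.exp_le_exp.2
      nlinarith [Real.pi_gt_three, sq_nonneg x]
    have h2 : (x ^ 2) ^ n * Real.exp (-(x ^ 2)) ≤ n.factorial := by
      have h := Real.pow_div_factorial_le_exp (x ^ 2) (sq_nonneg x) n
      rw [div_le_iff₀ (by positivity)] at h
      rw [Real.exp_neg, ← div_eq_mul_inv, div_le_iff₀ (Real.exp_pos _)]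
      linarith
    have h3 : |x ^ n| ≤ 1 + (x ^ 2) ^ n := by
      have h : (x ^ 2) ^ n = |x ^ n| ^ 2 := by
        rw [sq_abs]
        ring
      rw [h]
      nlinarith [sq_nonneg (|x ^ n| - 1), abs_nonneg (x ^ n)]
    have h4 : Real.exp (-(x ^ 2)) ≤ 1 := Real.exp_le_one_iff.2 (by nlinarith [sq_nonneg x])
    calc |x ^ n| * Real.exp (-Real.pi * x ^ 2)
        ≤ (1 + (x ^ 2) ^ n) * Real.exp (-(x ^ 2)) := by gcongr
      _ = Real.exp (-(x ^ 2)) + (x ^ 2) ^ n * Real.exp (-(x ^ 2)) := by ring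
      _ ≤ 1 + n.factorial := add_le_add h4 h2

theorem deriv_polyExp (c : ℝ) (p : Polynomial ℝ) :
    deriv (fun x : ℝ => p.eval x * Real.exp (c * x ^ 2)) =
      fun x => (Polynomial.derivative p + Polynomial.C (2 * c) * Polynomial.X * p).eval x *
        Real.exp (c * x ^ 2) := by
  funext x
  have h : HasDerivAt (fun x : ℝ => p.eval x * Real.exp (c * x ^ 2)) _ x :=
    (p.hasDerivAt x).mul (((hasDerivAt_pow 2 x).const_mul c).exp)
  rw [h.deriv]
  simp only [Polynomial.eval_add, Polynomial.eval_mul, Polynomial.eval_C, Polynomial.eval_X]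
  push_cast
  ring

theorem iteratedDeriv_polyExp (c : ℝ) (n : ℕ) (p : Polynomial ℝ) :
    ∃ q : Polynomial ℝ, iteratedDeriv n (fun x : ℝ => p.eval x * Real.exp (c * x ^ 2)) =
      fun x => q.eval x * Real.exp (c * x ^ 2) := by
  induction n generalizing p with
  | zero => exact ⟨p, by simp⟩
  | succ n ih =>
    rw [iteratedDeriv_succ', deriv_polyExp]
    exact ih _

theorem decay_of_polyGauss {f : ℝ → ℝ} (p : Polynomial ℝ)
    (hf : f = fun x => p.eval x * Real.exp (-Real.pi * x ^ 2)) (k n : ℕ) :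
    ∃ C : ℝ, ∀ x, ‖x‖ ^ k * ‖iteratedFDeriv ℝ n f x‖ ≤ C := by
  obtain ⟨q, hq⟩ := iteratedDeriv_polyExp (-Real.pi) n p
  obtain ⟨C, hC⟩ := polyGauss_bound (Polynomial.X ^ k * q)
  refine ⟨C, fun x => ?_⟩
  rw [norm_iteratedFDeriv_eq_norm_iteratedDeriv, hf, hq]
  refine le_of_eq_of_le ?_ (hC x)
  simp [abs_mul, mul_assoc]

theorem contDiff_of_polyGauss {f : ℝ → ℝ} (p : Polynomial ℝ)
    (hf : f = fun x => p.eval x * Real.exp (-Real.pi * x ^ 2)) : ContDiff ℝ (⊤ : ℕ∞) f := by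
  subst hf
  have h : ContDiff ℝ (⊤ : ℕ∞) (fun x : ℝ => p.eval x) := by
    simpa using p.contDiff_aeval (𝕜 := ℝ) (⊤ : ℕ∞)
  fun_prop

/-! ### Window, Hermite functions -/

/-- The real Schwartz function `g(t) = 2^{1/4} exp (-π t²)`. -/
def gaussWindow : 𝓢(ℝ, ℝ) where
  toFun t := (2 : ℝ) ^ (1 / 4 : ℝ) * Real.exp (-Real.pi * t ^ 2)
  smooth' := contDiff_of_polyGauss (Polynomial.C ((2 : ℝ) ^ (1 / 4 : ℝ))) (by simp)
  decay' := decay_of_polyGauss (Polynomial.C ((2 : ℝ) ^ (1 / 4 : ℝ))) (by simp)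

/-- The `k`-th Hermite function
`h_k(x) = (-1)^k / √(2^{2k-1/2} π^k k!) · exp (π x²) · (d/dx)^k exp (-2π x²)`,
normalised in `L²(ℝ)`. -/
def hermiteFun (k : ℕ) (x : ℝ) : ℝ :=
  (-1) ^ k / √((2 : ℝ) ^ (2 * (k : ℝ) - 1 / 2) * Real.pi ^ k * (k.factorial : ℝ)) *
    Real.exp (Real.pi * x ^ 2) *
      iteratedDeriv k (fun t : ℝ => Real.exp (-2 * Real.pi * t ^ 2)) x

theorem hermiteFun_eq (k : ℕ) : ∃ p : Polynomial ℝ,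
    hermiteFun k = fun x => p.eval x * Real.exp (-Real.pi * x ^ 2) := by
  obtain ⟨q, hq⟩ := iteratedDeriv_polyExp (-2 * Real.pi) k 1
  simp only [Polynomial.eval_one, one_mul] at hq
  refine ⟨Polynomial.C ((-1) ^ k /
    √((2 : ℝ) ^ (2 * (k : ℝ) - 1 / 2) * Real.pi ^ k * (k.factorial : ℝ))) * q, ?_⟩
  funext x
  have h : Real.exp (-Real.pi * x ^ 2) =
      Real.exp (Real.pi * x ^ 2) * Real.exp (-2 * Real.pi * x ^ 2) := by
    rw [← Real.exp_add]
    ring_nf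
  rw [hermiteFun, hq, h, Polynomial.eval_mul, Polynomial.eval_C]
  ring

/-- The Hermite function `h_k` as a real Schwartz function. -/
def hermite (k : ℕ) : 𝓢(ℝ, ℝ) where
  toFun := hermiteFun k
  smooth' := (hermiteFun_eq k).elim fun p hp => contDiff_of_polyGauss p hp
  decay' := (hermiteFun_eq k).elim fun p hp => decay_of_polyGauss p hp

/-- A real Schwartz function regarded as a complex one. -/
def toComplex (φ : 𝓢(ℝ, ℝ)) : 𝓢(ℝ, ℂ) := postcompCLM Complex.ofRealCLM φ

theorem toComplex_apply (φ : 𝓢(ℝ, ℝ)) (t : ℝ) : toComplex φ t = (φ t : ℂ) := rfl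

/-! ### Short-time Fourier transform of tempered distributions -/

theorem hasTemperateGrowth_character (v : ℝ) :
    (fun t : ℝ => Complex.exp (2 * Real.pi * Complex.I * v * t)).HasTemperateGrowth := by
  have key : ∀ (c : ℂ) (n : ℕ), iteratedDeriv n (fun t : ℝ => Complex.exp (c * t)) =
      fun t : ℝ => c ^ n * Complex.exp (c * t) := by
    intro c n
    induction n with
    | zero => simp
    | succ n ih =>
      rw [iteratedDeriv_succ, ih]
      funext t
      have h : HasDerivAt (fun s : ℝ => Complex.exp (c * s)) (Complex.exp (c * t) * c) t := by
        simpa using ((Complex.ofRealCLM.hasDerivAt (x := t)).const_mul c).cexp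
      rw [(h.const_mul (c ^ n)).deriv]
      ring
  have hc : ContDiff ℝ (⊤ : ℕ∞) (fun t : ℝ => (t : ℂ)) := Complex.ofRealCLM.contDiff
  refine ⟨by fun_prop, fun n => ⟨0, ‖2 * Real.pi * Complex.I * v‖ ^ n, fun t => ?_⟩⟩
  rw [norm_iteratedFDeriv_eq_norm_iteratedDeriv, key, norm_mul, norm_pow]
  have h : ‖Complex.exp (2 * Real.pi * Complex.I * v * t)‖ = 1 := by
    rw [show (2 * Real.pi * Complex.I * v * t : ℂ) = ((2 * Real.pi * v * t : ℝ) : ℂ) * Complex.I by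
      push_cast; ring]
    exact Complex.norm_exp_ofReal_mul_I _
  rw [h]
  simp

/-- The time-frequency shift `M_v T_u φ : t ↦ exp (2π i v t) φ(t - u)`. -/
def timeFreqShift (u v : ℝ) (φ : 𝓢(ℝ, ℂ)) : 𝓢(ℝ, ℂ) :=
  smulLeftCLM ℂ (fun t : ℝ => Complex.exp (2 * Real.pi * Complex.I * v * t))
    (compSubConstCLM ℂ u φ)

theorem timeFreqShift_apply (u v : ℝ) (φ : 𝓢(ℝ, ℂ)) (t : ℝ) :
    timeFreqShift u v φ t = Complex.exp (2 * Real.pi * Complex.I * v * t) * φ (t - u) := by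
  rw [timeFreqShift, smulLeftCLM_apply_apply (hasTemperateGrowth_character v)]
  rfl

/-- The complex conjugate of a Schwartz function. -/
def conjugate (φ : 𝓢(ℝ, ℂ)) : 𝓢(ℝ, ℂ) :=
  postcompCLM (Complex.conjCLE : ℂ →L[ℝ] ℂ) φ

theorem conjugate_apply (φ : 𝓢(ℝ, ℂ)) (t : ℝ) :
    conjugate φ t = (starRingEnd ℂ) (φ t) := rfl

/-- The Gabor transform `V_g T (u, v) = ⟨T, M_v T_u g⟩` of a tempered distribution. The bracket is
conjugate linear in the test function, so that for a function `f` this is the inner product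
`∫ f(t) conj (M_v T_u g (t)) dt`. (For a real `T` the linear bracket gives the complex conjugate
number, hence the same modulus.) -/
def gabor (T : 𝓢'(ℝ, ℂ)) (u v : ℝ) : ℂ :=
  T (conjugate (timeFreqShift u v (toComplex gaussWindow)))

/-- The Hermite function `h_k` as a tempered distribution. -/
def hermiteDist (k : ℕ) : 𝓢'(ℝ, ℂ) := toTemperedDistributionCLM ℝ ℂ volume (toComplex (hermite k))

theorem gabor_hermiteDist (k : ℕ) (u v : ℝ) :
    gabor (hermiteDist k) u v = ∫ t : ℝ, (hermiteFun k t : ℂ) *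
      (starRingEnd ℂ) (Complex.exp (2 * Real.pi * Complex.I * v * t) *
        (((2 : ℝ) ^ (1 / 4 : ℝ) * Real.exp (-Real.pi * (t - u) ^ 2) : ℝ) : ℂ)) := by
  refine (toTemperedDistributionCLM_apply_apply volume (toComplex (hermite k)) _).trans ?_
  congr 1
  funext t
  rw [conjugate_apply, timeFreqShift_apply, smul_eq_mul, mul_comm]
  rfl

/-! ### White noise -/

/-- `ξ` is a (real, unit) Gaussian white noise: a random tempered distribution, real on real test
functions, with characteristic functional `E exp (i ⟨ξ, φ⟩) = exp (-‖φ‖² / 2)`, where `‖φ‖` is the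
`L²(ℝ)` norm. -/
structure IsWhiteNoise {Ω : Type*} [MeasurableSpace Ω] (P : Measure Ω) (ξ : Ω → 𝓢'(ℝ, ℂ)) :
    Prop where
  measurable : ∀ φ : 𝓢(ℝ, ℝ), Measurable fun ω => ξ ω (toComplex φ)
  real : ∀ φ : 𝓢(ℝ, ℝ), ∀ᵐ ω ∂P, (ξ ω (toComplex φ)).im = 0
  charFun : ∀ φ : 𝓢(ℝ, ℝ), ∫ ω, Complex.exp (Complex.I * ξ ω (toComplex φ)) ∂P =
    Complex.exp (-(((∫ t : ℝ, φ t ^ 2) / 2 : ℝ) : ℂ))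

/-! ### Level sets and statistics -/

/-- The box `max (|u|, |v|) ≤ L` in the time-frequency plane. -/
def box (L : ℝ) : Set (ℝ × ℝ) := {p | max |p.1| |p.2| ≤ L}

/-- The spectrogram level set `{(u, v) ∈ box L : |V_g y (u, v)| ≥ γ}`. -/
def levelSet (L : ℝ) (y : 𝓢'(ℝ, ℂ)) (γ : ℝ) : Set (ℝ × ℝ) :=
  {p ∈ box L | γ ≤ ‖gabor y p.1 p.2‖}

/-! The statistics below are functions of the observed family of level sets `Λ`. -/

open Classical in
/-- The test `ψ_θ`, the indicator of `Λ θ` being non-empty. -/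
def test (Λ : ℝ → Set (ℝ × ℝ)) (θ : ℝ) : ℕ := if (Λ θ).Nonempty then 1 else 0

/-- `θ̂ = max {θ ≥ 0 : ψ_θ = 1}`. -/
def thetaHat (Λ : ℝ → Set (ℝ × ℝ)) : ℝ := sSup {θ : ℝ | test Λ θ = 1 ∧ 0 ≤ θ}

/-- `k̂`, the integer nearest to `π (min {|z| : z ∈ Λ(θ̂)})²`. -/
def kHat (Λ : ℝ → Set (ℝ × ℝ)) : ℕ :=
  (round (Real.pi * sInf {r : ℝ | ∃ p ∈ Λ (thetaHat Λ), r = √(p.1 ^ 2 + p.2 ^ 2)} ^ 2)).toNat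

/-- `λ̂ = θ̂ / ∏_{t=1}^{k̂} √(k̂ / (e t))`. -/
def lambdaHat (Λ : ℝ → Set (ℝ × ℝ)) : ℝ :=
  thetaHat Λ / ∏ t ∈ Finset.Icc 1 (kHat Λ), √((kHat Λ : ℝ) / (Real.exp 1 * t))

/-! ### Constants -/

/-- `𝔐(l) = min_{1 ≤ k ≤ l} max_{u, v} |V_g h_k (u, v)|`. -/
def minimaxPeak (l : ℕ) : ℝ :=
  ⨅ k : Finset.Icc 1 l, ⨆ p : ℝ × ℝ, ‖gabor (hermiteDist k) p.1 p.2‖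

/-- `C(k, r) = (1 + r)^k / exp (k (r + r² / 2))`. -/
def peakRatio (k : ℕ) (r : ℝ) : ℝ := (1 + r) ^ k / Real.exp (k * (r + r ^ 2 / 2))

/-- `β(k) = max (C(k, 1/(4k+2)), C(k, -1/(4k+2)))`. -/
def beta (k : ℕ) : ℝ :=
  max (peakRatio k (1 / (4 * k + 2))) (peakRatio k (-(1 / (4 * k + 2))))

/-- `C(k₀) = 2 / (5 (1 - max_{1 ≤ k ≤ k₀} β(k))) + 1`. -/
def modeConst (k₀ : ℕ) : ℝ := 2 / (5 * (1 - ⨆ k : Finset.Icc 1 k₀, beta k)) + 1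

end Gabor

end

noncomputable section

namespace Gabor

open Filter Topology ProbabilityTheory
open scoped NNReal ENNReal

/-! ### The Gabor transform as an entire function -/

/-! The Gabor transform of any tempered distribution is, up to an explicit weight, an entire
function: pairing with `bargmannKernel w` is holomorphic in `w` and has modulus `exp (π (re w)²)`
times that of the transform at `conj w`. A supremum is therefore controlled by local averages, with
no chaining.

Noise bound. Recentre the entire function at a point `w`. The mean value property and Jensen's
inequality bound `exp (|V(w)|² / 4)` by a constant times the integral of `exp (3/8 |V|²)` over the
disc of radius 1/4 about `w` (`exp_gaborAbs_le_setIntegral`). For white noise the expectation of the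
integrand is at most 2 at every point, because the window has unit norm and 3/8 < 1/2. Enlarging all
the discs to one ball of radius `2L`, Fubini and Markov give a union-type bound over the whole box
(`one_sub_le_prob_gabor_le`). The choice of level then yields (i) with `K = 1`.

Signal. With `s = π(u² + v²)` one has `|V h_k|² = s^k e^{-s} / k!`. This profile is unimodal, is
maximal exactly at `s = k` with value `hermitePeak k ^ 2`, and `|V h_k|` falls to at most `beta k`
times its peak once `|s - k| ≥ 1/2` (`abs_sub_lt_half_of_beta_mul_lt`).

Estimator. On the event of small noise, `θ̂` is within the noise level of `|λ| hermitePeak k`. Every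
maximiser keeps a signal above the fraction `beta k` of the peak, so rounding recovers `k` exactly,
and dividing by the correct peak estimates `|λ|` (`abs_lambdaHat_div_sub_one_le`). Claim (ii) is
this deterministic statement on the event of (i). -/

/-- The remainder of the exponential series after `n` terms. -/
def expTail (n : ℕ) (z : ℂ) : ℂ := Complex.exp z - ∑ m ∈ Finset.range n, z ^ m / m.factorial

/-- The truncated `n - 1` is correct also at `n = 0`: `expTail 0` is `exp`, its own derivative. -/
theorem hasDerivAt_expTail (n : ℕ) (z : ℂ) : HasDerivAt (expTail n) (expTail (n - 1) z) z := by
  rcases n with _ | n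
  · have h : expTail 0 = Complex.exp := funext fun z => by simp [expTail]
    rw [h]
    exact Complex.hasDerivAt_exp z
  · have h : HasDerivAt (fun z : ℂ => ∑ m ∈ Finset.range (n + 1), z ^ m / m.factorial)
        (∑ m ∈ Finset.range (n + 1), ((m : ℂ) * z ^ (m - 1)) / m.factorial) z :=
      HasDerivAt.fun_sum fun m _ => (hasDerivAt_pow m z).div_const _
    refine ((Complex.hasDerivAt_exp z).sub h).congr_deriv ?_
    rw [Finset.sum_range_succ']
    simp only [expTail, Nat.add_sub_cancel, Nat.cast_zero, zero_mul, zero_div, add_zero]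
    congr 1
    refine Finset.sum_congr rfl fun m _ => ?_
    rw [Nat.factorial_succ]
    have : (m.factorial : ℂ) ≠ 0 := by exact_mod_cast m.factorial_ne_zero
    have : ((m : ℂ) + 1) ≠ 0 := by exact_mod_cast m.succ_ne_zero
    push_cast
    field_simp

theorem contDiff_expTail (n : ℕ) {N : WithTop ℕ∞} : ContDiff ℂ N (expTail n) := by
  unfold expTail
  fun_prop

theorem norm_expTail_le (n : ℕ) (z : ℂ) : ‖expTail n z‖ ≤ ‖z‖ ^ n * Real.exp ‖z‖ :=
  Complex.norm_exp_sub_sum_le_norm_mul_exp z n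

/-- The Gaussian `exp (-π t² + 2 π w t)` with complex parameter `w`. -/
def gaussExp (w : ℂ) (t : ℝ) : ℂ := Complex.exp (-Real.pi * t ^ 2 + 2 * Real.pi * w * t)

/-- A polynomial times the remainder of `exp (2 π h t)` times a Gaussian. -/
def tailGauss (p : Polynomial ℂ) (i : ℕ) (h w : ℂ) (t : ℝ) : ℂ :=
  p.eval (t : ℂ) * expTail i (2 * Real.pi * h * t) * gaussExp w t

theorem contDiff_tailGauss (p : Polynomial ℂ) (i : ℕ) (h w : ℂ) {N : WithTop ℕ∞} :
    ContDiff ℝ N (tailGauss p i h w) := by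
  have hc : ContDiff ℝ N (fun t : ℝ => (t : ℂ)) := Complex.ofRealCLM.contDiff
  have hp : ContDiff ℝ N (fun t : ℝ => p.eval (t : ℂ)) := by
    have h1 : ContDiff ℂ N (fun z : ℂ => p.eval z) := by
      simpa using p.contDiff_aeval (𝕜 := ℂ) N
    exact (h1.restrict_scalars ℝ).comp hc
  have ht : ContDiff ℝ N (fun t : ℝ => expTail i (2 * Real.pi * h * t)) :=
    ((contDiff_expTail i).restrict_scalars ℝ).comp (contDiff_const.mul hc)
  unfold tailGauss gaussExp
  fun_prop

theorem deriv_tailGauss (p : Polynomial ℂ) (i : ℕ) (h w : ℂ) :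
    deriv (tailGauss p i h w) =
      tailGauss (Polynomial.derivative p + Polynomial.C (2 * (Real.pi : ℂ)) *
        (Polynomial.C w - Polynomial.X) * p) i h w +
      fun t => (2 * Real.pi * h) * tailGauss p (i - 1) h w t := by
  funext t
  have h1 : HasDerivAt (fun t : ℝ => p.eval (t : ℂ)) ((Polynomial.derivative p).eval (t : ℂ)) t :=
    (p.hasDerivAt (t : ℂ)).comp_ofReal
  have hl : HasDerivAt (fun t : ℝ => 2 * Real.pi * h * (t : ℂ)) (2 * Real.pi * h) t := by
    simpa using ((hasDerivAt_id (t : ℂ)).const_mul (2 * Real.pi * h)).comp_ofReal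
  have h2 : HasDerivAt (fun t : ℝ => expTail i (2 * Real.pi * h * t))
      (expTail (i - 1) (2 * Real.pi * h * t) * (2 * Real.pi * h)) t :=
    (hasDerivAt_expTail i _).comp t hl
  have h3 : HasDerivAt (fun t : ℝ => gaussExp w t)
      (gaussExp w t * (2 * Real.pi * (w - t))) t := by
    have := (((hasDerivAt_pow 2 (t : ℂ)).const_mul (-(Real.pi : ℂ))).add
      ((hasDerivAt_id (t : ℂ)).const_mul (2 * Real.pi * w))).cexp.comp_ofReal
    convert! this using 1
    simp [gaussExp]
    ring
  have := ((h1.mul h2).mul h3).deriv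
  simp only [Pi.add_apply]
  refine this.trans ?_
  simp [tailGauss]
  ring

theorem exists_norm_eval_le_exp (p : Polynomial ℂ) :
    ∃ C : ℝ, 0 ≤ C ∧ ∀ t : ℝ, ‖p.eval (t : ℂ)‖ ≤ C * Real.exp |t| := by
  induction p using Polynomial.induction_on' with
  | add p q hp hq =>
    obtain ⟨C, hC0, hC⟩ := hp
    obtain ⟨D, hD0, hD⟩ := hq
    refine ⟨C + D, by positivity, fun t => ?_⟩
    rw [Polynomial.eval_add, add_mul]
    exact (norm_add_le _ _).trans (add_le_add (hC t) (hD t))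
  | monomial n a =>
    refine ⟨‖a‖ * n.factorial, by positivity, fun t => ?_⟩
    have h := Real.pow_div_factorial_le_exp |t| (abs_nonneg t) n
    rw [div_le_iff₀ (by positivity)] at h
    rw [Polynomial.eval_monomial, norm_mul, norm_pow, Complex.norm_real, Real.norm_eq_abs]
    calc ‖a‖ * |t| ^ n ≤ ‖a‖ * (Real.exp |t| * n.factorial) := by gcongr
      _ = _ := by ring

theorem norm_gaussExp_le (w : ℂ) (t : ℝ) :
    ‖gaussExp w t‖ ≤ Real.exp (-Real.pi * t ^ 2 + 2 * Real.pi * ‖w‖ * |t|) := by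
  rw [gaussExp, Complex.norm_exp, Real.exp_le_exp]
  have h1 : (-Real.pi * (t : ℂ) ^ 2 + 2 * Real.pi * w * t : ℂ).re =
      -Real.pi * t ^ 2 + 2 * Real.pi * (w.re * t) := by
    simp [← Complex.ofReal_pow]
    ring
  rw [h1]
  have h2 : w.re * t ≤ ‖w‖ * |t| := by
    refine (le_abs_self _).trans ?_
    rw [abs_mul]
    exact mul_le_mul_of_nonneg_right (Complex.abs_re_le_norm w) (abs_nonneg t)
  nlinarith [Real.pi_pos]

/-- Functions of this shape are closed under differentiation. A derivative falling on the remainder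
lowers its order by one but releases a factor `h`, so the rate `‖h‖ ^ i` survives in every Schwartz
seminorm. -/
theorem exists_tailGauss_bound (m : ℕ) : ∀ (k i : ℕ) (p : Polynomial ℂ) (w : ℂ),
    ∃ C : ℝ, 0 ≤ C ∧ ∀ h : ℂ, ‖h‖ ≤ 1 → ∀ t : ℝ,
      |t| ^ k * ‖iteratedDeriv m (tailGauss p i h w) t‖ ≤ C * ‖h‖ ^ i := by
  induction m with
  | zero =>
    intro k i p w
    obtain ⟨C, hC0, hC⟩ := exists_norm_eval_le_exp (Polynomial.X ^ (k + i) * p)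
    -- All linear exponents in `|t|` add up to `a |t|`, and `a |t| - π t² ≤ a²`.
    set a : ℝ := 1 + 2 * Real.pi + 2 * Real.pi * ‖w‖ with ha
    refine ⟨C * (2 * Real.pi) ^ i * Real.exp (a ^ 2), by positivity, fun h hh t => ?_⟩
    have hC' := hC t
    simp only [Polynomial.eval_mul, Polynomial.eval_pow, Polynomial.eval_X, norm_mul, norm_pow,
      Complex.norm_real, Real.norm_eq_abs] at hC'
    have h2 := norm_expTail_le i (2 * Real.pi * h * t)
    have h2' : ‖(2 * Real.pi * h * t : ℂ)‖ = 2 * Real.pi * ‖h‖ * |t| := by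
      simp [abs_of_pos Real.pi_pos]
    rw [h2'] at h2
    have h3 : Real.exp (2 * Real.pi * ‖h‖ * |t|) ≤ Real.exp (2 * Real.pi * |t|) := by
      rw [Real.exp_le_exp]
      have : 0 ≤ 2 * Real.pi * |t| := by positivity
      nlinarith
    have h4 := norm_gaussExp_le w t
    have h5 : Real.exp |t| * Real.exp (2 * Real.pi * |t|) *
        Real.exp (-Real.pi * t ^ 2 + 2 * Real.pi * ‖w‖ * |t|) ≤ Real.exp (a ^ 2) := by
      rw [← Real.exp_add, ← Real.exp_add, Real.exp_le_exp]
      have : |t| ^ 2 = t ^ 2 := sq_abs t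
      nlinarith [Real.pi_gt_three, sq_nonneg (|t| - a), sq_nonneg t]
    rw [iteratedDeriv_zero, tailGauss, norm_mul, norm_mul]
    calc |t| ^ k * (‖p.eval (t : ℂ)‖ * ‖expTail i (2 * Real.pi * h * t)‖ * ‖gaussExp w t‖)
        ≤ |t| ^ k * (‖p.eval (t : ℂ)‖ * ((2 * Real.pi * ‖h‖ * |t|) ^ i *
          Real.exp (2 * Real.pi * |t|)) *
            Real.exp (-Real.pi * t ^ 2 + 2 * Real.pi * ‖w‖ * |t|)) := by
          gcongr
          exact h2.trans (by gcongr)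
      _ = (|t| ^ (k + i) * ‖p.eval (t : ℂ)‖) * ((2 * Real.pi) ^ i * ‖h‖ ^ i) *
          (Real.exp (2 * Real.pi * |t|) *
            Real.exp (-Real.pi * t ^ 2 + 2 * Real.pi * ‖w‖ * |t|)) := by
          rw [mul_pow, mul_pow (2 * Real.pi), pow_add]
          ring
      _ ≤ (C * Real.exp |t|) * ((2 * Real.pi) ^ i * ‖h‖ ^ i) *
          (Real.exp (2 * Real.pi * |t|) *
            Real.exp (-Real.pi * t ^ 2 + 2 * Real.pi * ‖w‖ * |t|)) := by gcongr
      _ = C * (2 * Real.pi) ^ i * (Real.exp |t| * Real.exp (2 * Real.pi * |t|) *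
        Real.exp (-Real.pi * t ^ 2 + 2 * Real.pi * ‖w‖ * |t|)) * ‖h‖ ^ i := by ring
      _ ≤ _ := by gcongr
  | succ m ih =>
    intro k i p w
    obtain ⟨C, hC0, hC⟩ := ih k i (Polynomial.derivative p + Polynomial.C (2 * (Real.pi : ℂ)) *
        (Polynomial.C w - Polynomial.X) * p) w
    obtain ⟨D, hD0, hD⟩ := ih k (i - 1) p w
    refine ⟨C + 2 * Real.pi * D, by positivity, fun h hh t => ?_⟩
    -- At `i = 0` the truncated exponent does not drop, and `‖h‖ ≤ 1` absorbs the extra factor.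
    have hpow : ‖h‖ * ‖h‖ ^ (i - 1) ≤ ‖h‖ ^ i := by
      rcases i with _ | i
      · simpa using hh
      · rw [Nat.add_sub_cancel, pow_succ']
    rw [iteratedDeriv_succ', deriv_tailGauss, iteratedDeriv_add
      (contDiff_tailGauss _ _ _ _).contDiffAt
      (contDiff_const.mul (contDiff_tailGauss _ _ _ _)).contDiffAt,
      iteratedDeriv_const_mul _ (contDiff_tailGauss _ _ _ _).contDiffAt]
    calc |t| ^ k * ‖_ + _‖ ≤ |t| ^ k * (_ + _) := by gcongr; exact norm_add_le _ _
      _ ≤ C * ‖h‖ ^ i + 2 * Real.pi * ‖h‖ * (D * ‖h‖ ^ (i - 1)) := by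
        rw [mul_add]
        refine add_le_add (hC h hh t) ?_
        rw [norm_mul, mul_left_comm]
        refine mul_le_mul (by simp [abs_of_pos Real.pi_pos]) (hD h hh t) (by positivity)
          (by positivity)
      _ = C * ‖h‖ ^ i + 2 * Real.pi * D * (‖h‖ * ‖h‖ ^ (i - 1)) := by ring
      _ ≤ _ := by rw [add_mul]; gcongr

/-- The Schwartz function `t ↦ 2^{1/4} exp (-π t² + 2 π w t)`. -/
def bargmannKernel (w : ℂ) : 𝓢(ℝ, ℂ) :=
  (Real.exp (Real.pi * w.re ^ 2) : ℂ) •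
    conjugate (timeFreqShift w.re (-w.im) (toComplex gaussWindow))

theorem bargmannKernel_apply (w : ℂ) (t : ℝ) :
    bargmannKernel w t = ((2 : ℝ) ^ (1 / 4 : ℝ) : ℝ) * gaussExp w t := by
  rw [bargmannKernel, smul_apply, conjugate_apply, timeFreqShift_apply, toComplex_apply]
  change _ * (starRingEnd ℂ) (_ * (((2 : ℝ) ^ (1 / 4 : ℝ) *
    Real.exp (-Real.pi * (t - w.re) ^ 2) : ℝ) : ℂ)) = _
  rw [map_mul, Complex.conj_ofReal, ← Complex.exp_conj, gaussExp]
  simp only [map_mul, Complex.conj_ofReal, Complex.conj_I, map_ofNat]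
  push_cast
  rw [mul_left_comm (Complex.exp _) (((2 : ℝ) ^ (1 / 4 : ℝ) : ℝ) : ℂ),
    mul_left_comm (Complex.exp _) (((2 : ℝ) ^ (1 / 4 : ℝ) : ℝ) : ℂ), ← Complex.exp_add,
    ← Complex.exp_add]
  congr 2
  conv_rhs => rw [← Complex.re_add_im w]
  ring

theorem hasTemperateGrowth_mul_ofReal (c : ℂ) :
    (fun t : ℝ => c * (t : ℂ)).HasTemperateGrowth :=
  (Function.HasTemperateGrowth.const c).mul Complex.ofRealCLM.hasTemperateGrowth

/-- The first-order Taylor remainder of the kernel in `w` is exactly a `tailGauss` of order 2, hence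
`O(‖h‖²)` in each seminorm. The difference quotient thus converges in Schwartz space, and continuity
of `T` transfers the limit. -/
theorem hasDerivAt_bargmannKernel (T : 𝓢'(ℝ, ℂ)) (w : ℂ) :
    HasDerivAt (fun w => T (bargmannKernel w))
      (T (smulLeftCLM ℂ (fun t : ℝ => 2 * Real.pi * (t : ℂ)) (bargmannKernel w))) w := by
  rw [hasDerivAt_iff_tendsto_slope_zero]
  simp only [← map_sub, ← map_smul]
  refine (T.continuous.tendsto _).comp ?_
  rw [(schwartz_withSeminorms ℂ ℝ ℂ).tendsto_nhds]
  rintro ⟨k, n⟩ ε hε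
  obtain ⟨C, hC0, hC⟩ := exists_tailGauss_bound n k 2
    (Polynomial.C (((2 : ℝ) ^ (1 / 4 : ℝ) : ℝ) : ℂ)) w
  have hsmall : ∀ᶠ h : ℂ in 𝓝[≠] 0, ‖h‖ < min 1 (ε / (C + 1)) :=
    nhdsWithin_le_nhds ((continuous_norm.tendsto' (0 : ℂ) 0 norm_zero).eventually_lt_const
      (by positivity))
  filter_upwards [hsmall, self_mem_nhdsWithin] with h hh h0
  have h0' : h ≠ 0 := h0
  have hn : 0 < ‖h‖ := norm_pos_iff.2 h0'
  set D := bargmannKernel (w + h) - bargmannKernel w -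
    h • smulLeftCLM ℂ (fun t : ℝ => 2 * Real.pi * (t : ℂ)) (bargmannKernel w) with hD
  have hcoe : (D : ℝ → ℂ) =
      tailGauss (Polynomial.C (((2 : ℝ) ^ (1 / 4 : ℝ) : ℝ) : ℂ)) 2 h w := by
    funext t
    rw [hD, sub_apply, sub_apply, smul_apply,
      smulLeftCLM_apply_apply (hasTemperateGrowth_mul_ofReal (2 * Real.pi))]
    simp only [bargmannKernel_apply, tailGauss, Polynomial.eval_C, smul_eq_mul, expTail,
      Finset.sum_range_succ, Finset.sum_range_zero]
    have : gaussExp (w + h) t = Complex.exp (2 * Real.pi * h * t) * gaussExp w t := by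
      rw [gaussExp, gaussExp, ← Complex.exp_add]
      ring_nf
    rw [this]
    simp
    ring
  have hsem : SchwartzMap.seminorm ℂ k n D ≤ C * ‖h‖ ^ 2 := by
    refine seminorm_le_bound' ℂ k n D (by positivity) fun t => ?_
    rw [hcoe]
    exact hC h (hh.le.trans (min_le_left _ _)) t
  have hEq : h⁻¹ • (bargmannKernel (w + h) - bargmannKernel w) -
      smulLeftCLM ℂ (fun t : ℝ => 2 * Real.pi * (t : ℂ)) (bargmannKernel w) = h⁻¹ • D := by
    rw [hD, smul_sub h⁻¹ (_ - _), smul_smul, inv_mul_cancel₀ h0', one_smul]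
  rw [schwartzSeminormFamily_apply, hEq, map_smul_eq_mul, norm_inv]
  calc ‖h‖⁻¹ * SchwartzMap.seminorm ℂ k n D ≤ ‖h‖⁻¹ * (C * ‖h‖ ^ 2) := by gcongr
    _ = C * ‖h‖ := by field_simp
    _ ≤ (C + 1) * ‖h‖ := by gcongr; linarith
    _ < (C + 1) * (ε / (C + 1)) := by
      gcongr
      exact hh.trans_le (min_le_right _ _)
    _ = ε := by field_simp

theorem differentiable_bargmannKernel (T : 𝓢'(ℝ, ℂ)) :
    Differentiable ℂ fun w => T (bargmannKernel w) :=
  fun w => (hasDerivAt_bargmannKernel T w).differentiableAt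

theorem apply_bargmannKernel (T : 𝓢'(ℝ, ℂ)) (w : ℂ) :
    T (bargmannKernel w) = Real.exp (Real.pi * w.re ^ 2) * gabor T w.re (-w.im) := by
  rw [bargmannKernel, map_smul, smul_eq_mul, gabor]

theorem continuous_gabor (T : 𝓢'(ℝ, ℂ)) : Continuous fun p : ℝ × ℝ => gabor T p.1 p.2 := by
  have h : (fun p : ℝ × ℝ => gabor T p.1 p.2) = fun p : ℝ × ℝ =>
      (Real.exp (-(Real.pi * p.1 ^ 2)) : ℂ) * T (bargmannKernel (⟨p.1, -p.2⟩ : ℂ)) := by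
    funext p
    rw [apply_bargmannKernel, ← mul_assoc, ← Complex.ofReal_mul, ← Real.exp_add]
    simp
  rw [h]
  have h1 : Continuous fun p : ℝ × ℝ => (⟨p.1, -p.2⟩ : ℂ) :=
    Complex.equivRealProdCLM.symm.continuous.comp (continuous_fst.prodMk continuous_snd.neg)
  exact (by fun_prop : Continuous fun p : ℝ × ℝ => (Real.exp (-(Real.pi * p.1 ^ 2)) : ℂ)).mul
    ((differentiable_bargmannKernel T).continuous.comp h1)

/-! ### A sub-mean value inequality on discs -/

theorem circleAverage_eq_of_differentiable {f : ℂ → ℂ} (hf : Differentiable ℂ f) (r : ℝ) :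
    ∫ θ in Set.Ioo (-Real.pi) Real.pi, f (r * (Real.cos θ + Real.sin θ * Complex.I)) =
      (2 * Real.pi : ℝ) • f 0 := by
  have h := (hf.diffContOnCl (s := Metric.ball (0 : ℂ) |r|)).circleAverage
  rw [Real.circleAverage_eq_integral_add (-Real.pi)] at h
  rw [← h, smul_smul, mul_inv_cancel₀ (by positivity), one_smul,
    ← integral_Ioc_eq_integral_Ioo, ← intervalIntegral.integral_of_le (by linarith [Real.pi_pos])]
  rw [intervalIntegral.integral_comp_add_right (fun θ => f (circleMap 0 r θ))]
  have h2 : 2 * Real.pi + -Real.pi = Real.pi := by ring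
  rw [zero_add, h2]
  simp only [circleMap, zero_add, Complex.exp_mul_I, Complex.ofReal_cos, Complex.ofReal_sin]

theorem setIntegral_ball_of_differentiable {f : ℂ → ℂ} (hf : Differentiable ℂ f) {r : ℝ}
    (hr : 0 ≤ r) : ∫ z in Metric.ball (0 : ℂ) r, f z = (Real.pi * r ^ 2 : ℝ) • f 0 := by
  rw [← integral_indicator Metric.isOpen_ball.measurableSet,
    ← Complex.integral_comp_polarCoord_symm]
  have hset : (Set.Ioo 0 r ×ˢ Set.Ioo (-Real.pi) Real.pi : Set (ℝ × ℝ)) ⊆ polarCoord.target := by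
    rintro ⟨x, y⟩ ⟨hx, hy⟩
    exact ⟨hx.1, hy⟩
  have h1 : ∫ p in polarCoord.target,
        p.1 • (Metric.ball (0 : ℂ) r).indicator f (Complex.polarCoord.symm p) =
      ∫ p in Set.Ioo 0 r ×ˢ Set.Ioo (-Real.pi) Real.pi,
        (p.1 : ℂ) * f (p.1 * (Real.cos p.2 + Real.sin p.2 * Complex.I)) := by
    symm
    rw [← integral_indicator (measurableSet_Ioo.prod measurableSet_Ioo),
      ← integral_indicator polarCoord.open_target.measurableSet]
    congr 1
    funext p
    by_cases hp : p ∈ polarCoord.target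
    · have hp1 : 0 < p.1 := hp.1
      rw [Set.indicator_of_mem hp]
      by_cases hp2 : p.1 < r
      · have hmem : p ∈ Set.Ioo 0 r ×ˢ Set.Ioo (-Real.pi) Real.pi := ⟨⟨hp1, hp2⟩, hp.2⟩
        rw [Set.indicator_of_mem hmem, Set.indicator_of_mem,
          Complex.polarCoord_symm_apply]
        · simp
        · simpa [abs_of_pos hp1] using hp2
      · rw [Set.indicator_of_notMem, Set.indicator_of_notMem, smul_zero]
        · simpa [abs_of_pos hp1] using hp2
        · rintro ⟨h, -⟩
          exact hp2 h.2
    · rw [Set.indicator_of_notMem hp, Set.indicator_of_notMem fun h => hp (hset h)]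
  have hcont : Continuous fun p : ℝ × ℝ =>
      (p.1 : ℂ) * f (p.1 * (Real.cos p.2 + Real.sin p.2 * Complex.I)) := by
    have := hf.continuous
    fun_prop
  have hint : IntegrableOn (fun p : ℝ × ℝ =>
      (p.1 : ℂ) * f (p.1 * (Real.cos p.2 + Real.sin p.2 * Complex.I)))
      (Set.Ioo 0 r ×ˢ Set.Ioo (-Real.pi) Real.pi) (volume.prod volume) :=
    (hcont.continuousOn.integrableOn_compact
      (isCompact_Icc.prod isCompact_Icc)).mono_set
        (Set.prod_mono Set.Ioo_subset_Icc_self Set.Ioo_subset_Icc_self)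
  rw [h1, Measure.volume_eq_prod, setIntegral_prod _ hint]
  simp only [integral_const_mul, circleAverage_eq_of_differentiable hf]
  rw [integral_mul_const, ← integral_Ioc_eq_integral_Ioo, ← intervalIntegral.integral_of_le hr,
    intervalIntegral.integral_ofReal, integral_id]
  simp only [Complex.real_smul]
  push_cast
  ring

theorem convexOn_exp_mul_norm_sq {c : ℝ} (hc : 0 ≤ c) :
    ConvexOn ℝ Set.univ fun z : ℂ => Real.exp (c * ‖z‖ ^ 2) := by
  have h1 : ConvexOn ℝ Set.univ fun z : ℂ => c * ‖z‖ ^ 2 := by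
    simpa using ((convexOn_univ_norm (E := ℂ)).pow (fun z _ => norm_nonneg z) 2).smul hc
  exact ⟨convex_univ, fun x hx y hy a b ha hb hab =>
    (Real.exp_le_exp.2 (h1.2 hx hy ha hb hab)).trans
      (convexOn_exp.2 (Set.mem_univ _) (Set.mem_univ _) ha hb hab)⟩

/-- The value `f 0` is the average of `f` over the disc, so Jensen's inequality applies to the
convex function `z ↦ exp (c ‖z‖²)`. -/
theorem exp_norm_sq_le_setIntegral {f : ℂ → ℂ} (hf : Differentiable ℂ f) {c r : ℝ} (hc : 0 ≤ c)
    (hr : 0 < r) : Real.pi * r ^ 2 * Real.exp (c * ‖f 0‖ ^ 2) ≤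
      ∫ z in Metric.ball (0 : ℂ) r, Real.exp (c * ‖f z‖ ^ 2) := by
  have hvol : volume.real (Metric.ball (0 : ℂ) r) = Real.pi * r ^ 2 := by
    rw [Measure.real, Complex.volume_ball]
    simp [hr.le, mul_comm]
  have hsub : Metric.ball (0 : ℂ) r ⊆ Metric.closedBall 0 r := Metric.ball_subset_closedBall
  have hf1 : IntegrableOn f (Metric.ball (0 : ℂ) r) :=
    (hf.continuous.continuousOn.integrableOn_compact (isCompact_closedBall _ _)).mono_set hsub
  have hg : Continuous fun z : ℂ => Real.exp (c * ‖z‖ ^ 2) := by fun_prop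
  have hf2 : IntegrableOn ((fun z : ℂ => Real.exp (c * ‖z‖ ^ 2)) ∘ f) (Metric.ball (0 : ℂ) r) :=
    ((hg.comp hf.continuous).continuousOn.integrableOn_compact
      (isCompact_closedBall _ _)).mono_set hsub
  have h := (convexOn_exp_mul_norm_sq hc).map_set_average_le hg.continuousOn isClosed_univ
    (Metric.measure_ball_pos volume (0 : ℂ) hr).ne' measure_ball_lt_top.ne
    (Eventually.of_forall fun _ => Set.mem_univ _) hf1 hf2
  have hpos : 0 < Real.pi * r ^ 2 := by positivity
  rw [setAverage_eq, setAverage_eq, hvol, setIntegral_ball_of_differentiable hf hr.le, smul_smul,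
    inv_mul_cancel₀ hpos.ne', one_smul, smul_eq_mul, inv_mul_eq_div, le_div_iff₀ hpos] at h
  linarith

/-- The modulus of the Gabor transform at the point `conj w`. -/
def gaborAbs (T : 𝓢'(ℝ, ℂ)) (w : ℂ) : ℝ := ‖gabor T w.re (-w.im)‖

theorem continuous_gaborAbs (T : 𝓢'(ℝ, ℂ)) : Continuous (gaborAbs T) :=
  ((continuous_gabor T).comp
    (Complex.continuous_re.prodMk Complex.continuous_im.neg)).norm

/-- In `‖w + z‖² = ‖w‖² + 2 re (conj w · z) + ‖z‖²` all terms but the last are real parts of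
holomorphic functions of `z`. A holomorphic exponential factor removes them, and the remaining
weight depends only on the distance to `w`. -/
theorem exists_entire_norm_eq_gaborAbs (T : 𝓢'(ℝ, ℂ)) (w : ℂ) :
    ∃ f : ℂ → ℂ, Differentiable ℂ f ∧
      ∀ z, ‖f z‖ = Real.exp (Real.pi * ‖z‖ ^ 2 / 2) * gaborAbs T (w + z) := by
  refine ⟨fun z => T (bargmannKernel (w + z)) * Complex.exp (-(Real.pi * (w + z) ^ 2 / 2) -
    Real.pi * ‖w‖ ^ 2 / 2 - Real.pi * (starRingEnd ℂ w) * z), ?_, fun z => ?_⟩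
  · have h := differentiable_bargmannKernel T
    have h1 : Differentiable ℂ fun z => T (bargmannKernel (w + z)) :=
      h.comp (differentiable_id.const_add w)
    exact h1.mul (by fun_prop)
  · rw [norm_mul, apply_bargmannKernel, norm_mul, Complex.norm_real, Complex.norm_exp,
      Real.norm_eq_abs, Real.abs_exp, mul_right_comm, ← Real.exp_add, gaborAbs]
    congr 2
    rw [← Complex.ofReal_pow, Complex.sq_norm, Complex.sq_norm]
    simp [pow_two, Complex.normSq_apply]
    ring

/-- On a disc of radius 1/4 the squared weight `exp (π ‖z‖²)` is at most `exp (1/5) ≤ 3/2`, so the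
exponent 1/4 grows to at most 3/8. This stays below 1/2, the threshold for square-exponential
moments of a standard Gaussian. -/
theorem exp_gaborAbs_le_setIntegral (T : 𝓢'(ℝ, ℂ)) (w : ℂ) :
    Real.pi / 16 * Real.exp (gaborAbs T w ^ 2 / 4) ≤
      ∫ z in Metric.ball w (1 / 4), Real.exp (3 / 8 * gaborAbs T z ^ 2) := by
  obtain ⟨f, hf, hfw⟩ := exists_entire_norm_eq_gaborAbs T w
  have h := exp_norm_sq_le_setIntegral hf (c := 1 / 4) (by norm_num) (r := 1 / 4) (by norm_num)
  have h0 : ‖f 0‖ = gaborAbs T w := by simpa using hfw 0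
  have htrans : ∫ z in Metric.ball w (1 / 4), Real.exp (3 / 8 * gaborAbs T z ^ 2) =
      ∫ z in Metric.ball (0 : ℂ) (1 / 4), Real.exp (3 / 8 * gaborAbs T (w + z) ^ 2) := by
    rw [← integral_indicator Metric.isOpen_ball.measurableSet,
      ← integral_indicator Metric.isOpen_ball.measurableSet,
      ← integral_add_left_eq_self _ w]
    congr 1
    funext z
    simp [Set.indicator]
  rw [htrans]
  calc Real.pi / 16 * Real.exp (gaborAbs T w ^ 2 / 4)
      = Real.pi * (1 / 4) ^ 2 * Real.exp (1 / 4 * ‖f 0‖ ^ 2) := by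
        rw [h0]
        ring_nf
    _ ≤ _ := h
    _ ≤ _ := by
      have hc := continuous_gaborAbs T
      have hc' := hf.continuous
      refine setIntegral_mono_on ?_ ?_ Metric.isOpen_ball.measurableSet fun z hz => ?_
      · exact ((by fun_prop : Continuous fun z => Real.exp (1 / 4 * ‖f z‖ ^ 2)).continuousOn
          |>.integrableOn_compact (isCompact_closedBall _ _)).mono_set
            Metric.ball_subset_closedBall
      · exact ((by fun_prop : Continuous fun z =>
            Real.exp (3 / 8 * gaborAbs T (w + z) ^ 2)).continuousOn
          |>.integrableOn_compact (isCompact_closedBall _ _)).mono_set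
            Metric.ball_subset_closedBall
      · rw [Real.exp_le_exp, hfw, mul_pow, ← mul_assoc]
        refine mul_le_mul_of_nonneg_right ?_ (sq_nonneg _)
        have hz' : ‖z‖ ^ 2 ≤ (1 / 4) ^ 2 := by
          have : ‖z‖ < 1 / 4 := by simpa using hz
          gcongr
        rw [← Real.exp_nat_mul]
        have h1 : ((2 : ℕ) : ℝ) * (Real.pi * ‖z‖ ^ 2 / 2) ≤ 1 / 5 := by
          push_cast
          nlinarith [Real.pi_lt_d2, Real.pi_pos]
        have h2 : Real.exp (1 / 5) ≤ 3 / 2 := by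
          have := Real.exp_bound_div_one_sub_of_interval (x := 1 / 5) (by norm_num) (by norm_num)
          norm_num at this ⊢
          linarith
        have := (Real.exp_le_exp.2 h1).trans h2
        linarith

/-! ### Gaussian moments of white noise -/

/-- Tilting by `exp (3/8 · x² / v)` leaves an unnormalised Gaussian of variance `4v`, whose mass is
`√4 = 2`. -/
theorem lintegral_exp_sq_gaussianReal {v : ℝ≥0} (hv : v ≠ 0) :
    ∫⁻ x, ENNReal.ofReal (Real.exp (3 / 8 * (x ^ 2 / v))) ∂gaussianReal 0 v = 2 := by
  have hv0 : (0 : ℝ) < v := by positivity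
  rw [gaussianReal_of_var_ne_zero 0 hv,
    lintegral_withDensity_eq_lintegral_mul _ (measurable_gaussianPDF 0 v) (by fun_prop)]
  have h : ∀ x : ℝ, (gaussianPDF 0 v * fun x : ℝ =>
      ENNReal.ofReal (Real.exp (3 / 8 * (x ^ 2 / v)))) x =
      ENNReal.ofReal ((√(2 * Real.pi * v))⁻¹ * Real.exp (-(1 / (8 * v)) * x ^ 2)) := by
    intro x
    rw [Pi.mul_apply, gaussianPDF, ← ENNReal.ofReal_mul (gaussianPDFReal_nonneg _ _ _),
      gaussianPDFReal, mul_assoc, ← Real.exp_add]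
    congr 3
    field_simp
    ring
  simp only [h]
  rw [← ofReal_integral_eq_lintegral_ofReal
    ((integrable_exp_neg_mul_sq (by positivity)).const_mul _)
    (Eventually.of_forall fun x => by positivity), integral_const_mul, integral_gaussian]
  have h4 : Real.pi / (1 / (8 * v)) = 2 ^ 2 * (2 * Real.pi * v) := by
    field_simp
    ring
  rw [h4, Real.sqrt_mul (by positivity) (2 * Real.pi * v), Real.sqrt_sq (by norm_num)]
  have : √(2 * Real.pi * v) ≠ 0 := (Real.sqrt_pos.2 (by positivity)).ne'
  rw [mul_left_comm, inv_mul_cancel₀ this]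
  simp

variable {Ω : Type*} [MeasurableSpace Ω] {P : Measure Ω} {ξ : Ω → 𝓢'(ℝ, ℂ)}

theorem toComplex_smul (c : ℝ) (φ : 𝓢(ℝ, ℝ)) : toComplex (c • φ) = (c : ℂ) • toComplex φ := by
  ext t
  simp [toComplex_apply]

namespace IsWhiteNoise

theorem measurable_re (h : IsWhiteNoise P ξ) (φ : 𝓢(ℝ, ℝ)) :
    Measurable fun ω => (ξ ω (toComplex φ)).re :=
  Complex.measurable_re.comp (h.measurable φ)

/-- The characteristic functional along the line `s ↦ s • φ` is the characteristic function of this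
real variable. -/
theorem map_re_eq_gaussianReal [IsProbabilityMeasure P] (h : IsWhiteNoise P ξ) (φ : 𝓢(ℝ, ℝ)) :
    P.map (fun ω => (ξ ω (toComplex φ)).re) = gaussianReal 0 (∫ t : ℝ, φ t ^ 2).toNNReal := by
  have hm := h.measurable_re φ
  have : IsProbabilityMeasure (P.map fun ω => (ξ ω (toComplex φ)).re) :=
    Measure.isProbabilityMeasure_map hm.aemeasurable
  refine Measure.ext_of_charFun ?_
  funext s
  rw [charFun_gaussianReal, charFun_apply_real, integral_map hm.aemeasurable (by fun_prop)]
  have h0 : 0 ≤ ∫ t : ℝ, φ t ^ 2 := integral_nonneg fun t => sq_nonneg _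
  have h1 := h.charFun (s • φ)
  have h2 : ∫ t : ℝ, (s • φ) t ^ 2 = s ^ 2 * ∫ t : ℝ, φ t ^ 2 := by
    simp only [smul_apply, smul_eq_mul, mul_pow]
    rw [integral_const_mul]
  rw [h2] at h1
  calc ∫ ω, Complex.exp (s * ((ξ ω (toComplex φ)).re : ℂ) * Complex.I) ∂P
      = ∫ ω, Complex.exp (Complex.I * ξ ω (toComplex (s • φ))) ∂P := by
        refine integral_congr_ae ?_
        filter_upwards [h.real φ] with ω hω
        have : ξ ω (toComplex φ) = ((ξ ω (toComplex φ)).re : ℂ) :=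
          Complex.ext (by simp) (by simp [hω])
        rw [toComplex_smul, map_smul, smul_eq_mul, ← this]
        ring_nf
    _ = _ := by
        rw [h1, Real.coe_toNNReal _ h0]
        congr 1
        push_cast
        ring

theorem lintegral_exp_sq_le_two [IsProbabilityMeasure P] (h : IsWhiteNoise P ξ) (φ : 𝓢(ℝ, ℝ)) :
    ∫⁻ ω, ENNReal.ofReal (Real.exp (3 / 8 * (‖ξ ω (toComplex φ)‖ ^ 2 / ∫ t : ℝ, φ t ^ 2))) ∂P
      ≤ 2 := by
  set v := (∫ t : ℝ, φ t ^ 2).toNNReal with hv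
  have h0 : 0 ≤ ∫ t : ℝ, φ t ^ 2 := integral_nonneg fun t => sq_nonneg _
  have hv' : ∫ t : ℝ, φ t ^ 2 = v := (Real.coe_toNNReal _ h0).symm
  rw [hv']
  rcases eq_or_ne v 0 with hv0 | hv0
  -- Division by zero gives 0, so the integrand is the constant 1.
  · simp [hv0]
  · refine le_of_eq ?_
    rw [← lintegral_exp_sq_gaussianReal hv0, hv, ← h.map_re_eq_gaussianReal φ,
      lintegral_map (by fun_prop) (h.measurable_re φ)]
    refine lintegral_congr_ae ?_
    filter_upwards [h.real φ] with ω hω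
    rw [Complex.sq_norm, Complex.normSq_apply, hω]
    ring_nf

theorem ae_eq_zero [IsProbabilityMeasure P] (h : IsWhiteNoise P ξ) {φ : 𝓢(ℝ, ℝ)}
    (hφ : ∫ t : ℝ, φ t ^ 2 = 0) : ∀ᵐ ω ∂P, ξ ω (toComplex φ) = 0 := by
  have hm := h.map_re_eq_gaussianReal φ
  rw [hφ, Real.toNNReal_zero, gaussianReal_zero_var] at hm
  have h1 : ∀ᵐ x ∂(P.map fun ω => (ξ ω (toComplex φ)).re), x = 0 := by
    rw [hm, ae_dirac_eq]
    simp
  filter_upwards [h.real φ, ae_of_ae_map (h.measurable_re φ).aemeasurable h1] with ω hω hω'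
  exact Complex.ext hω' hω

end IsWhiteNoise

/-- The real part of a complex Schwartz function. -/
def rePart (ψ : 𝓢(ℝ, ℂ)) : 𝓢(ℝ, ℝ) := postcompCLM Complex.reCLM ψ

/-- The imaginary part of a complex Schwartz function. -/
def imPart (ψ : 𝓢(ℝ, ℂ)) : 𝓢(ℝ, ℝ) := postcompCLM Complex.imCLM ψ

theorem toComplex_rePart_add_imPart (ψ : 𝓢(ℝ, ℂ)) :
    toComplex (rePart ψ) + Complex.I • toComplex (imPart ψ) = ψ := by
  ext t
  rw [add_apply, smul_apply, toComplex_apply, toComplex_apply, smul_eq_mul, mul_comm]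
  exact Complex.re_add_im (ψ t)

theorem integral_rePart_sq_add_integral_imPart_sq (ψ : 𝓢(ℝ, ℂ)) :
    (∫ t : ℝ, rePart ψ t ^ 2) + (∫ t : ℝ, imPart ψ t ^ 2) = ∫ t : ℝ, ‖ψ t‖ ^ 2 := by
  have hi : ∀ φ : 𝓢(ℝ, ℝ), Integrable fun t => φ t ^ 2 := fun φ =>
    (φ.memLp 2 volume).integrable_sq
  rw [← integral_add (hi _) (hi _)]
  congr 1
  funext t
  rw [Complex.sq_norm, Complex.normSq_apply, ← pow_two, ← pow_two]
  rfl

theorem exp_add_div_le {a b : ℝ} (ha : 0 ≤ a) (hb : 0 ≤ b) (hab : a + b = 1) (x y : ℝ) :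
    Real.exp (a * x + b * y) ≤ a * Real.exp x + b * Real.exp y :=
  convexOn_exp.2 (Set.mem_univ _) (Set.mem_univ _) ha hb hab

namespace IsWhiteNoise

theorem measurable_apply (h : IsWhiteNoise P ξ) (ψ : 𝓢(ℝ, ℂ)) : Measurable fun ω => ξ ω ψ := by
  have : (fun ω => ξ ω ψ) = fun ω => ξ ω (toComplex (rePart ψ)) +
      Complex.I * ξ ω (toComplex (imPart ψ)) := by
    funext ω
    rw [← smul_eq_mul, ← map_smul, ← map_add, toComplex_rePart_add_imPart]
  rw [this]
  exact (h.measurable _).add ((h.measurable _).const_mul _)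

/-- The real and imaginary parts of `ψ` give real Gaussians of variances `a` and `b` with `a + b =
1`. Convexity of `exp` with weights `a`, `b` reduces to each of them separately, so their
correlation plays no role. -/
theorem lintegral_exp_norm_sq_le_two [IsProbabilityMeasure P] (h : IsWhiteNoise P ξ)
    {ψ : 𝓢(ℝ, ℂ)} (hψ : ∫ t : ℝ, ‖ψ t‖ ^ 2 = 1) :
    ∫⁻ ω, ENNReal.ofReal (Real.exp (3 / 8 * ‖ξ ω ψ‖ ^ 2)) ∂P ≤ 2 := by
  set a := ∫ t : ℝ, rePart ψ t ^ 2 with ha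
  set b := ∫ t : ℝ, imPart ψ t ^ 2 with hb
  have ha0 : 0 ≤ a := integral_nonneg fun t => sq_nonneg _
  have hb0 : 0 ≤ b := integral_nonneg fun t => sq_nonneg _
  have hab : a + b = 1 := (integral_rePart_sq_add_integral_imPart_sq ψ).trans hψ
  -- When the variance is zero the pairing vanishes almost surely, so the identity survives division
  -- by zero.
  have key : ∀ φ : 𝓢(ℝ, ℝ), ∀ᵐ ω ∂P, ‖ξ ω (toComplex φ)‖ ^ 2 =
      (∫ t : ℝ, φ t ^ 2) * (‖ξ ω (toComplex φ)‖ ^ 2 / ∫ t : ℝ, φ t ^ 2) := by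
    intro φ
    by_cases hφ : ∫ t : ℝ, φ t ^ 2 = 0
    · filter_upwards [h.ae_eq_zero hφ] with ω hω
      simp [hω]
    · exact Eventually.of_forall fun ω => (mul_div_cancel₀ _ hφ).symm
  calc ∫⁻ ω, ENNReal.ofReal (Real.exp (3 / 8 * ‖ξ ω ψ‖ ^ 2)) ∂P
      ≤ ∫⁻ ω, (ENNReal.ofReal a *
          ENNReal.ofReal (Real.exp (3 / 8 * (‖ξ ω (toComplex (rePart ψ))‖ ^ 2 / a))) +
        ENNReal.ofReal b *
          ENNReal.ofReal (Real.exp (3 / 8 * (‖ξ ω (toComplex (imPart ψ))‖ ^ 2 / b)))) ∂P := by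
        refine lintegral_mono_ae ?_
        filter_upwards [key (rePart ψ), key (imPart ψ), h.real (rePart ψ), h.real (imPart ψ)]
          with ω h1 h2 h3 h4
        rw [← ENNReal.ofReal_mul ha0, ← ENNReal.ofReal_mul hb0,
          ← ENNReal.ofReal_add (by positivity) (by positivity)]
        refine ENNReal.ofReal_le_ofReal (le_trans (le_of_eq ?_) (exp_add_div_le ha0 hb0 hab _ _))
        rw [← ha] at h1
        rw [← hb] at h2
        congr 1
        have h5 : ξ ω ψ = ξ ω (toComplex (rePart ψ)) +
            Complex.I * ξ ω (toComplex (imPart ψ)) := by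
          rw [← smul_eq_mul, ← map_smul, ← map_add, toComplex_rePart_add_imPart]
        have h6 : ‖ξ ω ψ‖ ^ 2 = ‖ξ ω (toComplex (rePart ψ))‖ ^ 2 +
            ‖ξ ω (toComplex (imPart ψ))‖ ^ 2 := by
          rw [h5]
          simp [Complex.sq_norm, Complex.normSq_apply, h3, h4]
        rw [h6]
        linear_combination (3 / 8) * h1 + (3 / 8) * h2
    _ = ENNReal.ofReal a * _ + ENNReal.ofReal b * _ := by
        have hm : ∀ (φ : 𝓢(ℝ, ℝ)) (c : ℝ), Measurable fun ω =>
            ENNReal.ofReal (Real.exp (3 / 8 * (‖ξ ω (toComplex φ)‖ ^ 2 / c))) := fun φ c => by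
          have := h.measurable φ
          fun_prop
        rw [lintegral_add_left ((hm _ _).const_mul _), lintegral_const_mul _ (hm _ _),
          lintegral_const_mul _ (hm _ _)]
    _ ≤ ENNReal.ofReal a * 2 + ENNReal.ofReal b * 2 := by
        gcongr
        · exact h.lintegral_exp_sq_le_two (rePart ψ)
        · exact h.lintegral_exp_sq_le_two (imPart ψ)
    _ = 2 := by
        rw [← add_mul, ← ENNReal.ofReal_add ha0 hb0, hab, ENNReal.ofReal_one, one_mul]

theorem measurable_gabor (h : IsWhiteNoise P ξ) (u v : ℝ) :
    Measurable fun ω => gabor (ξ ω) u v := h.measurable_apply _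

theorem lintegral_exp_gabor_le_two [IsProbabilityMeasure P] (h : IsWhiteNoise P ξ) (u v : ℝ) :
    ∫⁻ ω, ENNReal.ofReal (Real.exp (3 / 8 * ‖gabor (ξ ω) u v‖ ^ 2)) ∂P ≤ 2 := by
  refine h.lintegral_exp_norm_sq_le_two ?_
  have h1 : ∀ t : ℝ, ‖conjugate (timeFreqShift u v (toComplex gaussWindow)) t‖ ^ 2 =
      √2 * Real.exp (-(2 * Real.pi) * (t - u) ^ 2) := by
    intro t
    rw [conjugate_apply, timeFreqShift_apply, toComplex_apply, RCLike.norm_conj, norm_mul,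
      Complex.norm_exp, Complex.norm_real, Real.norm_eq_abs, mul_pow, sq_abs]
    change _ * ((2 : ℝ) ^ (1 / 4 : ℝ) * Real.exp (-Real.pi * (t - u) ^ 2)) ^ 2 = _
    have h2 : (2 * Real.pi * Complex.I * v * t : ℂ).re = 0 := by simp
    have h3 : ((2 : ℝ) ^ (1 / 4 : ℝ)) ^ 2 = √2 := by
      rw [← Real.rpow_natCast, ← Real.rpow_mul (by norm_num), Real.sqrt_eq_rpow]
      norm_num
    rw [mul_pow, h2, h3, ← Real.exp_nat_mul (-Real.pi * _), Real.exp_zero, one_pow, one_mul]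
    congr 2
    push_cast
    ring
  simp only [h1]
  rw [integral_const_mul, integral_sub_right_eq_self (fun t => Real.exp (-(2 * Real.pi) * t ^ 2)),
    integral_gaussian, ← Real.sqrt_mul (by norm_num)]
  rw [show 2 * (Real.pi / (2 * Real.pi)) = 1 by field_simp, Real.sqrt_one]

end IsWhiteNoise

/-! ### The supremum of the noise over a box -/

/-- One large value anywhere in the box makes the integral over a fixed ball large. The disc of
radius 1/4 fits because `√2 L + 1/4 ≤ 2L` for `L ≥ 1`. -/
theorem ofReal_le_lintegral_exp_gaborAbs (T : 𝓢'(ℝ, ℂ)) {L M : ℝ} (hL : 1 ≤ L) {p : ℝ × ℝ}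
    (hp : p ∈ box L) (hM : 0 ≤ M) (hMp : M ≤ ‖gabor T p.1 p.2‖) :
    ENNReal.ofReal (Real.pi / 16 * Real.exp (M ^ 2 / 4)) ≤
      ∫⁻ w in Metric.ball (0 : ℂ) (2 * L),
        ENNReal.ofReal (Real.exp (3 / 8 * gaborAbs T w ^ 2)) := by
  obtain ⟨u, v⟩ := p
  obtain ⟨hu, hv⟩ : |u| ≤ L ∧ |v| ≤ L := max_le_iff.1 hp
  set w : ℂ := ⟨u, -v⟩ with hw
  have hgw : M ≤ gaborAbs T w := by simpa [gaborAbs, hw] using hMp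
  have hsubset : Metric.ball w (1 / 4) ⊆ Metric.ball (0 : ℂ) (2 * L) := by
    refine Metric.ball_subset_ball' ?_
    have h1 : ‖w‖ ^ 2 ≤ 2 * L ^ 2 := by
      rw [Complex.sq_norm, Complex.normSq_apply]
      have := sq_le_sq' (abs_le.1 hu).1 (abs_le.1 hu).2
      have := sq_le_sq' (abs_le.1 hv).1 (abs_le.1 hv).2
      simp only [hw]
      linarith
    have h2 : ‖w‖ ≤ 3 / 2 * L := abs_le_of_sq_le_sq' (by nlinarith) (by linarith) |>.2
    rw [dist_zero_right]
    linarith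
  have hc : Continuous fun z => Real.exp (3 / 8 * gaborAbs T z ^ 2) := by
    have := continuous_gaborAbs T
    fun_prop
  have hi : IntegrableOn (fun z => Real.exp (3 / 8 * gaborAbs T z ^ 2))
      (Metric.ball w (1 / 4)) :=
    (hc.continuousOn.integrableOn_compact (isCompact_closedBall _ _)).mono_set
      Metric.ball_subset_closedBall
  calc ENNReal.ofReal (Real.pi / 16 * Real.exp (M ^ 2 / 4))
      ≤ ENNReal.ofReal (∫ z in Metric.ball w (1 / 4),
          Real.exp (3 / 8 * gaborAbs T z ^ 2)) := by
        refine ENNReal.ofReal_le_ofReal (le_trans ?_ (exp_gaborAbs_le_setIntegral T w))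
        gcongr
    _ = ∫⁻ z in Metric.ball w (1 / 4),
          ENNReal.ofReal (Real.exp (3 / 8 * gaborAbs T z ^ 2)) :=
        ofReal_integral_eq_lintegral_ofReal hi (Eventually.of_forall fun z => by positivity)
    _ ≤ _ := lintegral_mono_set hsubset

namespace IsWhiteNoise

theorem measurable_uncurry_gaborAbs (h : IsWhiteNoise P ξ) :
    Measurable (Function.uncurry fun (w : ℂ) (ω : Ω) => gaborAbs (ξ ω) w) :=
  measurable_uncurry_of_continuous_of_measurable (fun ω => continuous_gaborAbs (ξ ω))
    fun w => (h.measurable_gabor w.re (-w.im)).norm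

theorem measurable_exp_gaborAbs (h : IsWhiteNoise P ξ) :
    Measurable fun p : Ω × ℂ => ENNReal.ofReal (Real.exp (3 / 8 * gaborAbs (ξ p.1) p.2 ^ 2)) := by
  have h1 : Measurable fun p : Ω × ℂ => gaborAbs (ξ p.1) p.2 :=
    h.measurable_uncurry_gaborAbs.comp measurable_swap
  exact ((h1.pow_const 2).const_mul (3 / 8)).exp.ennreal_ofReal

theorem lintegral_lintegral_exp_gaborAbs_le [IsProbabilityMeasure P] (h : IsWhiteNoise P ξ)
    {R : ℝ} (hR : 0 ≤ R) :
    ∫⁻ ω, (∫⁻ w in Metric.ball (0 : ℂ) R,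
      ENNReal.ofReal (Real.exp (3 / 8 * gaborAbs (ξ ω) w ^ 2))) ∂P ≤
      ENNReal.ofReal (2 * Real.pi * R ^ 2) := by
  rw [lintegral_lintegral_swap h.measurable_exp_gaborAbs.aemeasurable]
  calc ∫⁻ w in Metric.ball (0 : ℂ) R, ∫⁻ ω,
        ENNReal.ofReal (Real.exp (3 / 8 * gaborAbs (ξ ω) w ^ 2)) ∂P
      ≤ ∫⁻ _ in Metric.ball (0 : ℂ) R, 2 :=
        lintegral_mono fun w => h.lintegral_exp_gabor_le_two w.re (-w.im)
    _ = 2 * (ENNReal.ofReal R ^ 2 * NNReal.pi) := by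
        rw [setLIntegral_const, Complex.volume_ball]
    _ = ENNReal.ofReal (2 * Real.pi * R ^ 2) := by
        rw [← ENNReal.ofReal_pow hR, ← ENNReal.ofReal_coe_nnreal, NNReal.coe_real_pi,
          ← ENNReal.ofReal_mul (by positivity),
          show (2 : ℝ≥0∞) = ENNReal.ofReal 2 by simp, ← ENNReal.ofReal_mul (by norm_num)]
        ring_nf

theorem measurable_lintegral_exp_gaborAbs (h : IsWhiteNoise P ξ) (s : Set ℂ) :
    Measurable fun ω => ∫⁻ w in s,
      ENNReal.ofReal (Real.exp (3 / 8 * gaborAbs (ξ ω) w ^ 2)) :=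
  h.measurable_exp_gaborAbs.lintegral_prod_right'

/-- Markov's inequality for the integral over the ball, whose mean is at most `2 · π (2L)²` by
Fubini. Dividing by `π/16 · exp (M²/4)` produces the factor 128. -/
theorem one_sub_le_prob_gabor_le [IsProbabilityMeasure P] (h : IsWhiteNoise P ξ) {L M : ℝ}
    (hL : 1 ≤ L) (hM : 0 ≤ M) : 1 - 128 * L ^ 2 * Real.exp (-(M ^ 2 / 4)) ≤
      P.real {ω | ∀ p ∈ box L, ‖gabor (ξ ω) p.1 p.2‖ ≤ M} := by
  set ε : ℝ := Real.pi / 16 * Real.exp (M ^ 2 / 4) with hε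
  have hε0 : 0 < ε := by positivity
  set A : Set Ω := {ω | ∀ p ∈ box L, ‖gabor (ξ ω) p.1 p.2‖ ≤ M} with hA
  have hsub : Aᶜ ⊆ {ω | ENNReal.ofReal ε ≤ ∫⁻ w in Metric.ball (0 : ℂ) (2 * L),
      ENNReal.ofReal (Real.exp (3 / 8 * gaborAbs (ξ ω) w ^ 2))} := by
    intro ω hω
    simp only [hA, Set.mem_compl_iff, Set.mem_ofPred_eq, not_forall, not_le] at hω
    obtain ⟨p, hp, hlt⟩ := hω
    exact ofReal_le_lintegral_exp_gaborAbs (ξ ω) hL hp hM hlt.le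
  have hbad : P Aᶜ ≤ ENNReal.ofReal (128 * L ^ 2 * Real.exp (-(M ^ 2 / 4))) := by
    calc P Aᶜ ≤ _ := measure_mono hsub
      _ ≤ _ := meas_ge_le_lintegral_div
          (h.measurable_lintegral_exp_gaborAbs _).aemeasurable (by simpa using hε0)
          ENNReal.ofReal_ne_top
      _ ≤ ENNReal.ofReal (2 * Real.pi * (2 * L) ^ 2) / ENNReal.ofReal ε := by
        gcongr
        exact h.lintegral_lintegral_exp_gaborAbs_le (by linarith)
      _ = ENNReal.ofReal (128 * L ^ 2 * Real.exp (-(M ^ 2 / 4))) := by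
        rw [← ENNReal.ofReal_div_of_pos hε0, hε, Real.exp_neg]
        congr 1
        field_simp
        norm_num
  have hbad' : P.real Aᶜ ≤ 128 * L ^ 2 * Real.exp (-(M ^ 2 / 4)) :=
    ENNReal.toReal_le_of_le_ofReal (by positivity) hbad
  -- Subadditivity suffices here, so the event `A` need not be shown measurable.
  have huniv := measureReal_union_le (μ := P) A Aᶜ
  rw [Set.union_compl_self, probReal_univ] at huniv
  linarith

theorem prob_sup_gabor_le [IsProbabilityMeasure P] (h : IsWhiteNoise P ξ) {L τ : ℝ}
    (hL : Real.pi ≤ L) (hτ : 0 < τ) :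
    1 - 4 * Real.exp (-(τ ^ 2 / (2 * Real.pi) * Real.log L)) ≤
      P.real {ω | ∀ p ∈ box L,
        √Real.pi * ‖gabor (ξ ω) p.1 p.2‖ ≤ √2 * (14 + τ) * √(Real.log L)} := by
  have hπ := Real.pi_gt_three
  have hπ4 := Real.pi_le_four
  have hL1 : 1 ≤ L := by linarith
  have hL0 : 0 < L := by linarith
  have hlog : 0 ≤ Real.log L := Real.log_nonneg hL1
  have hsπ : 0 < √Real.pi := Real.sqrt_pos.2 Real.pi_pos
  set M : ℝ := √2 * (14 + τ) * √(Real.log L) / √Real.pi with hM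
  have hset : {ω | ∀ p ∈ box L,
        √Real.pi * ‖gabor (ξ ω) p.1 p.2‖ ≤ √2 * (14 + τ) * √(Real.log L)} =
      {ω | ∀ p ∈ box L, ‖gabor (ξ ω) p.1 p.2‖ ≤ M} := by
    ext ω
    simp only [Set.mem_ofPred_eq, hM, le_div_iff₀ hsπ, mul_comm √Real.pi]
  rw [hset]
  refine le_trans ?_ (h.one_sub_le_prob_gabor_le (M := M) hL1 (by positivity))
  have hM2 : M ^ 2 / 4 = (14 + τ) ^ 2 / (2 * Real.pi) * Real.log L := by
    rw [hM, div_pow, mul_pow, mul_pow, Real.sq_sqrt (by norm_num), Real.sq_sqrt hlog,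
      Real.sq_sqrt Real.pi_pos.le]
    field_simp
    ring
  -- This is where 14 is used: it buys a factor `L^{-6}`, which absorbs `L²` and leaves `L^{-4}`
  -- against `128 / 4 = 32`.
  have h6 : 6 ≤ (14 : ℝ) ^ 2 / (2 * Real.pi) := by
    rw [le_div_iff₀ (by positivity)]
    linarith
  have hexp : Real.exp (-(M ^ 2 / 4)) ≤
      Real.exp (-(τ ^ 2 / (2 * Real.pi) * Real.log L)) * (L ^ 6)⁻¹ := by
    have hL6 : (L ^ 6)⁻¹ = Real.exp (-(6 * Real.log L)) := by
      rw [Real.exp_neg, mul_comm, Real.exp_mul, Real.exp_log hL0]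
      norm_cast
    rw [hL6, ← Real.exp_add, Real.exp_le_exp, hM2]
    have h7 : 6 + τ ^ 2 / (2 * Real.pi) ≤ (14 + τ) ^ 2 / (2 * Real.pi) := by
      have : (14 + τ) ^ 2 / (2 * Real.pi) =
          14 ^ 2 / (2 * Real.pi) + τ ^ 2 / (2 * Real.pi) + 28 * τ / (2 * Real.pi) := by ring
      have : 0 ≤ 28 * τ / (2 * Real.pi) := by positivity
      linarith
    nlinarith
  have hL4 : 32 ≤ L ^ 4 := by
    calc (32 : ℝ) ≤ 3 ^ 4 := by norm_num
      _ ≤ L ^ 4 := by gcongr; linarith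
  have hfin : 128 * L ^ 2 * Real.exp (-(M ^ 2 / 4)) ≤
      4 * Real.exp (-(τ ^ 2 / (2 * Real.pi) * Real.log L)) := by
    set E := Real.exp (-(τ ^ 2 / (2 * Real.pi) * Real.log L))
    have hE : 0 ≤ E := (Real.exp_pos _).le
    calc 128 * L ^ 2 * Real.exp (-(M ^ 2 / 4)) ≤ 128 * L ^ 2 * (E * (L ^ 6)⁻¹) := by gcongr
      _ = 4 * E * (32 / L ^ 4) := by field_simp; ring
      _ ≤ 4 * E * 1 := by
        gcongr
        exact div_le_one_of_le₀ hL4 (by positivity)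
      _ = 4 * E := mul_one _
  linarith

end IsWhiteNoise

/-! ### The Gabor transform of the Hermite functions -/

theorem integrable_cexp_mul_polyExp (a : ℂ) (q : Polynomial ℝ) :
    Integrable fun t : ℝ =>
      Complex.exp (a * t) * ((q.eval t * Real.exp (-2 * Real.pi * t ^ 2) : ℝ) : ℂ) := by
  obtain ⟨C, hC0, hC⟩ := exists_norm_eval_le_exp (q.map (algebraMap ℝ ℂ))
  set b := ‖a‖ + 1 with hb
  refine Integrable.mono' ((integrable_exp_neg_mul_sq Real.pi_pos).const_mul
    (C * Real.exp (b ^ 2))) (by fun_prop) (Eventually.of_forall fun t => ?_)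
  have h1 : |q.eval t| ≤ C * Real.exp |t| := by
    have h := hC t
    rw [← Complex.coe_algebraMap, Polynomial.eval_map_algebraMap,
      Polynomial.aeval_algebraMap_apply] at h
    simpa using h
  have h2 : ‖Complex.exp (a * t)‖ ≤ Real.exp (‖a‖ * |t|) := by
    refine (Complex.norm_exp_le_exp_norm _).trans (le_of_eq ?_)
    simp
  rw [norm_mul, Complex.norm_real, Real.norm_eq_abs, abs_mul, Real.abs_exp]
  calc ‖Complex.exp (a * t)‖ * (|q.eval t| * Real.exp (-2 * Real.pi * t ^ 2))
      ≤ Real.exp (‖a‖ * |t|) * ((C * Real.exp |t|) * Real.exp (-2 * Real.pi * t ^ 2)) := by gcongr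
    _ = C * Real.exp (b * |t| + -2 * Real.pi * t ^ 2) := by
      rw [show b * |t| + -2 * Real.pi * t ^ 2 = ‖a‖ * |t| + (|t| + -2 * Real.pi * t ^ 2) by
        rw [hb]; ring, Real.exp_add, Real.exp_add]
      ring
    _ ≤ C * Real.exp (b ^ 2 + -Real.pi * t ^ 2) := by
      refine mul_le_mul_of_nonneg_left (Real.exp_le_exp.2 ?_) hC0
      nlinarith [Real.pi_gt_three, sq_nonneg (|t| - b), sq_abs t, sq_nonneg t]
    _ = _ := by rw [Real.exp_add]; ring

/-- The `k`-th derivative of `exp (-2 π t²)`. -/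
def gaussIterDeriv (k : ℕ) : ℝ → ℝ := iteratedDeriv k fun t : ℝ => Real.exp (-2 * Real.pi * t ^ 2)

theorem gaussIterDeriv_eq (k : ℕ) : ∃ q : Polynomial ℝ,
    gaussIterDeriv k = fun t => q.eval t * Real.exp (-2 * Real.pi * t ^ 2) := by
  obtain ⟨q, hq⟩ := iteratedDeriv_polyExp (-2 * Real.pi) k 1
  exact ⟨q, by simpa only [Polynomial.eval_one, one_mul] using! hq⟩

theorem hasDerivAt_gaussIterDeriv (k : ℕ) (t : ℝ) :
    HasDerivAt (gaussIterDeriv k) (gaussIterDeriv (k + 1) t) t := by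
  have hd : Differentiable ℝ (gaussIterDeriv k) := by
    obtain ⟨q, hq⟩ := gaussIterDeriv_eq k
    rw [hq]
    exact q.differentiable.mul (by fun_prop)
  convert! (hd t).hasDerivAt using 1
  rw [gaussIterDeriv, iteratedDeriv_succ]
  rfl

/-- Each integration by parts moves one derivative onto the exponential and contributes `-a`. A
Gaussian integral remains. -/
theorem integral_cexp_mul_iteratedDeriv (a : ℂ) (k : ℕ) :
    ∫ t : ℝ, Complex.exp (a * t) *
      (gaussIterDeriv k t : ℂ) =
    (-a) ^ k * ((Real.pi / (2 * Real.pi)) ^ (1 / 2 : ℂ) *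
      Complex.exp (a ^ 2 / (8 * Real.pi))) := by
  have hint : ∀ k, Integrable fun t : ℝ => Complex.exp (a * t) *
      (gaussIterDeriv k t : ℂ) := fun k => by
    obtain ⟨q, hq⟩ := gaussIterDeriv_eq k
    rw [hq]
    exact integrable_cexp_mul_polyExp a q
  induction k with
  | zero =>
    have h := integral_cexp_quadratic (b := -(2 * Real.pi)) (by simp [Real.pi_pos]) a 0
    rw [pow_zero, one_mul]
    convert h using 2
    · funext t
      rw [gaussIterDeriv, iteratedDeriv_zero, Complex.ofReal_exp, ← Complex.exp_add]
      congr 1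
      push_cast
      ring
    · rw [neg_neg]
    · congr 1
      have : (Real.pi : ℂ) ≠ 0 := by exact_mod_cast Real.pi_ne_zero
      field_simp
      ring
  | succ k ih =>
    have hu : ∀ t : ℝ, HasDerivAt (fun t : ℝ => Complex.exp (a * t)) (a * Complex.exp (a * t)) t :=
      fun t => by
        simpa [mul_comm] using (((hasDerivAt_id (t : ℂ)).const_mul a).cexp).comp_ofReal
    have hv : ∀ t : ℝ, HasDerivAt
        (fun t : ℝ => (gaussIterDeriv k t : ℂ))
        (gaussIterDeriv (k + 1) t : ℂ) t := fun t => (hasDerivAt_gaussIterDeriv k t).ofReal_comp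
    have h := integral_mul_deriv_eq_deriv_mul_of_integrable (fun t _ => hu t) (fun t _ => hv t)
      (hint (k + 1)) (by simpa [Pi.mul_def, mul_assoc] using! (hint k).const_mul a) (hint k)
    rw [h]
    simp only [mul_assoc]
    rw [integral_const_mul, ih, pow_succ]
    ring

/-- The factor `exp (π t²)` in `h_k` cancels the quadratic decay of the window, so the transform is
a two-sided Laplace transform of the `k`-th derivative of `exp (-2π t²)`, evaluated at a multiple of
`w = u - iv`. -/
theorem norm_gabor_hermiteDist_sq (k : ℕ) (u v : ℝ) :
    ‖gabor (hermiteDist k) u v‖ ^ 2 = (Real.pi * (u ^ 2 + v ^ 2)) ^ k *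
      Real.exp (-(Real.pi * (u ^ 2 + v ^ 2))) / k.factorial := by
  set c : ℝ := √((2 : ℝ) ^ (2 * (k : ℝ) - 1 / 2) * Real.pi ^ k * (k.factorial : ℝ)) with hc
  set w : ℂ := ⟨u, -v⟩ with hw
  have hw' : w = u - v * Complex.I := by
    apply Complex.ext <;> simp [hw]
  have h1 : gabor (hermiteDist k) u v = (((-1) ^ k / c * (2 : ℝ) ^ (1 / 4 : ℝ) *
      Real.exp (-(Real.pi * u ^ 2)) : ℝ) : ℂ) * ∫ t : ℝ, Complex.exp (2 * Real.pi * w * t) *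
      (gaussIterDeriv k t : ℂ) := by
    rw [gabor_hermiteDist, ← integral_const_mul]
    congr 1
    funext t
    rw [map_mul, Complex.conj_ofReal, ← Complex.exp_conj, hermiteFun, ← hc, ← gaussIterDeriv]
    simp only [map_mul, Complex.conj_ofReal, Complex.conj_I, map_ofNat]
    push_cast
    have hexp : Complex.exp (Real.pi * t ^ 2) * (Complex.exp (2 * Real.pi * -Complex.I * v * t) *
        Complex.exp (-Real.pi * (t - u) ^ 2)) =
        Complex.exp (-(Real.pi * u ^ 2)) * Complex.exp (2 * Real.pi * w * t) := by
      rw [← Complex.exp_add, ← Complex.exp_add, ← Complex.exp_add, hw']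
      ring_nf
    linear_combination ((-1) ^ k / (c : ℂ) * (((2 : ℝ) ^ (1 / 4 : ℝ) : ℝ) : ℂ) *
      (gaussIterDeriv k t : ℂ)) * hexp
  have hr : (Real.pi / (2 * Real.pi) : ℂ) = ((1 / 2 : ℝ) : ℂ) := by
    have : (Real.pi : ℂ) ≠ 0 := by exact_mod_cast Real.pi_ne_zero
    push_cast
    field_simp
  have h2 : ‖((1 / 2 : ℝ) : ℂ) ^ (1 / 2 : ℂ)‖ ^ 2 = 1 / 2 := by
    rw [Complex.norm_cpow_eq_rpow_re_of_pos (by norm_num), ← Real.rpow_natCast,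
      ← Real.rpow_mul (by norm_num)]
    norm_num
  have hre : ((2 * Real.pi * w) ^ 2 / (8 * Real.pi) : ℂ).re =
      Real.pi * (u ^ 2 - v ^ 2) / 2 := by
    have : ((2 * Real.pi * w) ^ 2 / (8 * Real.pi) : ℂ) = ((Real.pi / 2 : ℝ) : ℂ) * w ^ 2 := by
      have : (Real.pi : ℂ) ≠ 0 := by exact_mod_cast Real.pi_ne_zero
      push_cast
      field_simp
      ring
    rw [this, Complex.re_ofReal_mul, pow_two]
    simp [hw]
    ring
  have hwn : ‖w‖ ^ 2 = u ^ 2 + v ^ 2 := by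
    rw [Complex.sq_norm, Complex.normSq_apply]
    simp only [hw]
    ring
  have hc2 : c ^ 2 = (2 : ℝ) ^ (2 * k) / √2 * Real.pi ^ k * k.factorial := by
    rw [hc, Real.sq_sqrt (by positivity), Real.rpow_sub (by norm_num), Real.sqrt_eq_rpow]
    norm_cast
  have h24 : ((2 : ℝ) ^ (1 / 4 : ℝ)) ^ 2 = √2 := by
    rw [← Real.rpow_natCast, ← Real.rpow_mul (by norm_num), Real.sqrt_eq_rpow]
    norm_num
  have hE : Real.exp (-(Real.pi * (u ^ 2 + v ^ 2))) = Real.exp (-(Real.pi * u ^ 2)) ^ 2 *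
      Real.exp (Real.pi * (u ^ 2 - v ^ 2) / 2) ^ 2 := by
    rw [← Real.exp_nat_mul, ← Real.exp_nat_mul, ← Real.exp_add]
    congr 1
    push_cast
    ring
  have hpow : ((2 * Real.pi * ‖w‖) ^ k) ^ 2 =
      2 ^ (2 * k) * Real.pi ^ k * (Real.pi * (u ^ 2 + v ^ 2)) ^ k := by
    rw [← pow_mul, mul_comm k 2, pow_mul, mul_pow, hwn, pow_mul, ← mul_pow, ← mul_pow]
    ring_nf
  have hs : √2 * √2 = (2 : ℝ) := Real.mul_self_sqrt (by norm_num)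
  have hs0 : √2 ≠ (0 : ℝ) := by positivity
  have hc0 : 0 ≤ c := Real.sqrt_nonneg _
  have hnorm : ‖(((-1) ^ k / c * (2 : ℝ) ^ (1 / 4 : ℝ) *
      Real.exp (-(Real.pi * u ^ 2)) : ℝ) : ℂ)‖ =
      1 / c * (2 : ℝ) ^ (1 / 4 : ℝ) * Real.exp (-(Real.pi * u ^ 2)) := by
    rw [Complex.norm_real, Real.norm_eq_abs, abs_mul, abs_mul, abs_div, abs_pow, abs_neg, abs_one,
      one_pow, abs_of_nonneg hc0, Real.abs_exp, abs_of_nonneg (by positivity)]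
  have hnorm' : ‖(-(2 * Real.pi * w) : ℂ) ^ k‖ = (2 * Real.pi * ‖w‖) ^ k := by
    simp [abs_of_pos Real.pi_pos]
  have hsq : ∀ x₁ x₂ x₃ x₄ x₅ x₆ : ℝ, (x₁ * x₂ * x₃ * (x₄ * (x₅ * x₆))) ^ 2 =
      x₁ ^ 2 * x₂ ^ 2 * x₃ ^ 2 * (x₄ ^ 2 * (x₅ ^ 2 * x₆ ^ 2)) := by
    intros
    ring
  rw [h1, integral_cexp_mul_iteratedDeriv, hr, norm_mul, norm_mul, norm_mul, Complex.norm_exp,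
    hre, hnorm, hnorm', hsq, h2, hpow, h24, div_pow, hc2,
    hE]
  field_simp
  linear_combination (Real.pi * (u ^ 2 + v ^ 2)) ^ k * hs

/-- The peak value of the modulus of the Gabor transform of `h_k`. -/
def hermitePeak (k : ℕ) : ℝ := ∏ t ∈ Finset.Icc 1 k, √((k : ℝ) / (Real.exp 1 * t))

theorem hermitePeak_pos (k : ℕ) : 0 < hermitePeak k := by
  refine Finset.prod_pos fun t ht => Real.sqrt_pos.2 ?_
  have h := Finset.mem_Icc.1 ht
  have h1 : 0 < t := by omega
  have h2 : 0 < k := by omega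
  positivity

theorem hermitePeak_sq (k : ℕ) :
    hermitePeak k ^ 2 = (k : ℝ) ^ k * Real.exp (-k) / k.factorial := by
  rw [hermitePeak, ← Finset.prod_pow]
  have h : ∀ t ∈ Finset.Icc 1 k, √((k : ℝ) / (Real.exp 1 * t)) ^ 2 =
      (k / Real.exp 1) * (t : ℝ)⁻¹ := fun t ht => by
    rw [Real.sq_sqrt (by positivity)]
    field_simp
  rw [Finset.prod_congr rfl h, Finset.prod_mul_distrib, Finset.prod_const, Nat.card_Icc,
    Nat.add_sub_cancel, Finset.prod_inv_distrib, ← Nat.cast_prod,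
    ← Finset.Ico_add_one_right_eq_Icc, Finset.prod_Ico_id_eq_factorial,
    div_pow, ← Real.exp_nat_mul, mul_one, Real.exp_neg]
  rfl

/-! ### Unimodality of `s^k e^{-s}` and the peak of the Hermite transform -/

theorem pow_mul_exp_neg_eq {k : ℕ} (hk : k ≠ 0) (s : ℝ) :
    s ^ k * Real.exp (-s) = (s * Real.exp (-(s / k))) ^ k := by
  have : (k : ℝ) ≠ 0 := by exact_mod_cast hk
  rw [mul_pow, ← Real.exp_nat_mul]
  congr 2
  field_simp

/-- After taking `k`-th roots the claim follows from `s/t ≤ exp (s/t - 1)`, since `(s - t)/t ≤ (s -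
t)/k` when `s ≤ t ≤ k`. The same inequality holds for `k ≤ t ≤ s`, which gives the companion lemma.
-/
theorem pow_mul_exp_neg_le_of_le {k : ℕ} (hk : k ≠ 0) {s t : ℝ} (hs : 0 ≤ s) (hst : s ≤ t)
    (htk : t ≤ k) : s ^ k * Real.exp (-s) ≤ t ^ k * Real.exp (-t) := by
  have hk0 : (0 : ℝ) < k := by positivity
  rw [pow_mul_exp_neg_eq hk, pow_mul_exp_neg_eq hk]
  rcases (hs.trans hst).eq_or_lt with ht | ht
  · have : s = t := by linarith
    rw [this]
  gcongr ?_ ^ k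
  have h1 : s / t ≤ Real.exp (s / t - 1) := by linarith [Real.add_one_le_exp (s / t - 1)]
  have h2 : s / t - 1 ≤ s / k - t / k := by
    rw [div_sub_one ht.ne', ← sub_div, div_le_div_iff₀ ht hk0]
    nlinarith
  have h3 := h1.trans (Real.exp_le_exp.2 h2)
  rw [div_le_iff₀ ht] at h3
  calc s * Real.exp (-(s / k)) ≤ (Real.exp (s / k - t / k) * t) * Real.exp (-(s / k)) := by gcongr
    _ = t * (Real.exp (s / k - t / k) * Real.exp (-(s / k))) := by ring
    _ = t * Real.exp (-(t / k)) := by rw [← Real.exp_add]; ring_nf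

theorem pow_mul_exp_neg_le_of_ge {k : ℕ} (hk : k ≠ 0) {s t : ℝ} (hst : t ≤ s)
    (htk : k ≤ t) : s ^ k * Real.exp (-s) ≤ t ^ k * Real.exp (-t) := by
  have hk0 : (0 : ℝ) < k := by positivity
  have ht : 0 < t := hk0.trans_le htk
  have hs : 0 < s := ht.trans_le hst
  rw [pow_mul_exp_neg_eq hk, pow_mul_exp_neg_eq hk]
  gcongr ?_ ^ k
  have h1 : s / t ≤ Real.exp (s / t - 1) := by linarith [Real.add_one_le_exp (s / t - 1)]
  have h2 : s / t - 1 ≤ s / k - t / k := by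
    rw [div_sub_one ht.ne', ← sub_div]
    gcongr
  have h3 := h1.trans (Real.exp_le_exp.2 h2)
  rw [div_le_iff₀ ht] at h3
  calc s * Real.exp (-(s / k)) ≤ (Real.exp (s / k - t / k) * t) * Real.exp (-(s / k)) := by gcongr
    _ = t * (Real.exp (s / k - t / k) * Real.exp (-(s / k))) := by ring
    _ = t * Real.exp (-(t / k)) := by rw [← Real.exp_add]; ring_nf

theorem norm_gabor_hermiteDist_le {k : ℕ} (hk : k ≠ 0) (u v : ℝ) :
    ‖gabor (hermiteDist k) u v‖ ≤ hermitePeak k := by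
  refine abs_le_of_sq_le_sq' ?_ (hermitePeak_pos k).le |>.2
  rw [norm_gabor_hermiteDist_sq, hermitePeak_sq]
  gcongr ?_ / _
  rcases le_total (Real.pi * (u ^ 2 + v ^ 2)) k with h | h
  · exact pow_mul_exp_neg_le_of_le hk (by positivity) h le_rfl
  · exact pow_mul_exp_neg_le_of_ge hk h le_rfl

theorem norm_gabor_hermiteDist_peak (k : ℕ) :
    ‖gabor (hermiteDist k) √((k : ℝ) / Real.pi) 0‖ = hermitePeak k := by
  refine (sq_eq_sq₀ (norm_nonneg _) (hermitePeak_pos k).le).1 ?_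
  rw [norm_gabor_hermiteDist_sq, hermitePeak_sq, Real.sq_sqrt (by positivity)]
  have : Real.pi * (k / Real.pi + 0 ^ 2) = k := by
    field_simp
    ring
  rw [this]

theorem iSup_norm_gabor_hermiteDist {k : ℕ} (hk : k ≠ 0) :
    ⨆ p : ℝ × ℝ, ‖gabor (hermiteDist k) p.1 p.2‖ = hermitePeak k := by
  refine le_antisymm (ciSup_le fun p => norm_gabor_hermiteDist_le hk _ _) ?_
  rw [← norm_gabor_hermiteDist_peak k]
  exact le_ciSup (f := fun p : ℝ × ℝ => ‖gabor (hermiteDist k) p.1 p.2‖)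
    ⟨hermitePeak k, by rintro _ ⟨p, rfl⟩; exact norm_gabor_hermiteDist_le hk _ _⟩
    (√((k : ℝ) / Real.pi), 0)

/-! ### Decay away from the peak circle -/

theorem peakRatio_pos {k : ℕ} {r : ℝ} (hr : -1 < r) : 0 < peakRatio k r :=
  div_pos (pow_pos (by linarith) k) (Real.exp_pos _)

theorem peakRatio_lt_one {k : ℕ} (hk : k ≠ 0) {r : ℝ} (hr : -1 < r) (hr0 : r ≠ 0) :
    peakRatio k r < 1 := by
  rw [peakRatio, div_lt_one (Real.exp_pos _), Real.exp_nat_mul]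
  refine pow_lt_pow_left₀ ?_ (by linarith) hk
  calc 1 + r ≤ Real.exp r := by linarith [Real.add_one_le_exp r]
    _ < _ := by
      rw [Real.exp_lt_exp]
      have : 0 < r ^ 2 := by positivity
      linarith

/-- This explains `peakRatio`: it is the height relative to the peak when the radius is scaled by `1
+ r`, that is, at `s = k (1 + r)²`. -/
theorem peakRatio_sq_mul_hermitePeak_sq (k : ℕ) (r : ℝ) :
    (peakRatio k r * hermitePeak k) ^ 2 = ((k * (1 + r) ^ 2) ^ k *
      Real.exp (-(k * (1 + r) ^ 2))) / k.factorial := by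
  have h : Real.exp (-(k * (1 + r) ^ 2)) * Real.exp (k * (r + r ^ 2 / 2)) ^ 2 =
      Real.exp (-k) := by
    rw [← Real.exp_nat_mul, ← Real.exp_add]
    congr 1
    push_cast
    ring
  rw [mul_pow, hermitePeak_sq, peakRatio, div_pow, ← h, mul_pow (k : ℝ), ← pow_mul, ← pow_mul,
    mul_comm k 2]
  field_simp

theorem one_div_four_mul_add_two_mem (k : ℕ) :
    0 < 1 / (4 * (k : ℝ) + 2) ∧ 1 / (4 * (k : ℝ) + 2) ≤ 1 / 2 := by
  refine ⟨by positivity, ?_⟩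
  rw [div_le_div_iff₀ (by positivity) (by norm_num)]
  have : (0 : ℝ) ≤ k := by positivity
  linarith

theorem beta_lt_one {k : ℕ} (hk : k ≠ 0) : beta k < 1 := by
  obtain ⟨h1, h2⟩ := one_div_four_mul_add_two_mem k
  exact max_lt (peakRatio_lt_one hk (by linarith) h1.ne')
    (peakRatio_lt_one hk (by linarith) (neg_ne_zero.2 h1.ne'))

/-- With `r = 1/(4k + 2)` both points `k (1 ± r)²` lie within 1/2 of `k`. If `|s - k| ≥ 1/2`, then
`s` lies beyond one of them, and unimodality bounds the height by `beta k` times the peak. -/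
theorem abs_sub_lt_half_of_beta_mul_lt {k : ℕ} (hk : k ≠ 0) {u v : ℝ}
    (h : beta k * hermitePeak k < ‖gabor (hermiteDist k) u v‖) :
    |Real.pi * (u ^ 2 + v ^ 2) - k| < 1 / 2 := by
  by_contra! hcon
  obtain ⟨h1, h2⟩ := one_div_four_mul_add_two_mem k
  set r : ℝ := 1 / (4 * (k : ℝ) + 2) with hr
  have hk0 : (0 : ℝ) < k := by positivity
  have hkr : r * (4 * k + 2) = 1 := by
    rw [hr]
    field_simp
  have hs : 0 ≤ Real.pi * (u ^ 2 + v ^ 2) := by positivity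
  have key : ∃ r' : ℝ, -1 < r' ∧ peakRatio k r' ≤ beta k ∧
      (Real.pi * (u ^ 2 + v ^ 2)) ^ k * Real.exp (-(Real.pi * (u ^ 2 + v ^ 2))) ≤
        (k * (1 + r') ^ 2) ^ k * Real.exp (-(k * (1 + r') ^ 2)) := by
    rcases le_abs'.1 hcon with h3 | h3
    · refine ⟨-r, by linarith, le_max_right _ _, pow_mul_exp_neg_le_of_le hk hs ?_ ?_⟩
      · nlinarith
      · nlinarith
    · refine ⟨r, by linarith, le_max_left _ _, pow_mul_exp_neg_le_of_ge hk ?_ ?_⟩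
      · nlinarith
      · nlinarith
  obtain ⟨r', hr1, hr2, hr3⟩ := key
  have h4 : ‖gabor (hermiteDist k) u v‖ ≤ peakRatio k r' * hermitePeak k := by
    refine abs_le_of_sq_le_sq' ?_ (mul_pos (peakRatio_pos hr1) (hermitePeak_pos k)).le |>.2
    rw [norm_gabor_hermiteDist_sq, peakRatio_sq_mul_hermitePeak_sq]
    gcongr
  have h5 : peakRatio k r' * hermitePeak k ≤ beta k * hermitePeak k :=
    mul_le_mul_of_nonneg_right hr2 (hermitePeak_pos k).le
  linarith

/-! ### The estimator on a box where the noise is small -/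

theorem isCompact_box (L : ℝ) : IsCompact (box L) := by
  have : box L = Metric.closedBall (0 : ℝ × ℝ) L := by
    ext p
    simp [box, Prod.norm_def]
  rw [this]
  exact isCompact_closedBall _ _

theorem thetaHat_levelSet {L : ℝ} {y : 𝓢'(ℝ, ℂ)} {p : ℝ × ℝ} (hp : p ∈ box L)
    (hmax : ∀ q ∈ box L, ‖gabor y q.1 q.2‖ ≤ ‖gabor y p.1 p.2‖) :
    thetaHat (levelSet L y) = ‖gabor y p.1 p.2‖ := by
  have h : {θ : ℝ | test (levelSet L y) θ = 1 ∧ 0 ≤ θ} = Set.Icc 0 ‖gabor y p.1 p.2‖ := by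
    ext θ
    simp only [test, Set.mem_ofPred_eq, Set.mem_Icc, ite_eq_left_iff, zero_ne_one, imp_false,
      not_not]
    refine ⟨fun ⟨⟨q, hq, hθ⟩, h0⟩ => ⟨h0, hθ.trans (hmax q hq)⟩, fun ⟨h0, hθ⟩ => ⟨⟨p, hp, hθ⟩, h0⟩⟩
  rw [thetaHat, h, csSup_Icc (norm_nonneg _)]

theorem kHat_eq {Λ : ℝ → Set (ℝ × ℝ)} {k : ℕ} (hne : (Λ (thetaHat Λ)).Nonempty)
    (h : ∀ p ∈ Λ (thetaHat Λ), |Real.pi * (p.1 ^ 2 + p.2 ^ 2) - k| < 1 / 2)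
    (hc : IsCompact (Λ (thetaHat Λ))) : kHat Λ = k := by
  obtain ⟨p, hp, hmin⟩ := hc.exists_isMinOn hne
    (f := fun p : ℝ × ℝ => √(p.1 ^ 2 + p.2 ^ 2)) (by fun_prop)
  have hinf : sInf {r : ℝ | ∃ p ∈ Λ (thetaHat Λ), r = √(p.1 ^ 2 + p.2 ^ 2)} =
      √(p.1 ^ 2 + p.2 ^ 2) := by
    refine IsLeast.csInf_eq ⟨⟨p, hp, rfl⟩, ?_⟩
    rintro _ ⟨q, hq, rfl⟩
    exact hmin hq
  have hround : round (Real.pi * (p.1 ^ 2 + p.2 ^ 2)) = (k : ℤ) := by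
    rw [round_eq, Int.floor_eq_iff]
    have := abs_lt.1 (h p hp)
    push_cast
    constructor <;> linarith
  rw [kHat, hinf, Real.sq_sqrt (by positivity), hround, Int.toNat_natCast]

theorem gabor_add_smul (a b : ℂ) (S T : 𝓢'(ℝ, ℂ)) (u v : ℝ) :
    gabor (a • S + b • T) u v = a * gabor S u v + b * gabor T u v := rfl

theorem minimaxPeak_pos {k₀ : ℕ} (hk₀ : 1 ≤ k₀) : 0 < minimaxPeak k₀ := by
  have : Nonempty (Finset.Icc 1 k₀) := ⟨⟨1, Finset.mem_Icc.2 ⟨le_rfl, hk₀⟩⟩⟩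
  obtain ⟨k, hk⟩ := exists_eq_ciInf_of_finite
    (f := fun k : Finset.Icc 1 k₀ => ⨆ p : ℝ × ℝ, ‖gabor (hermiteDist k) p.1 p.2‖)
  rw [minimaxPeak, ← hk, iSup_norm_gabor_hermiteDist
    (Nat.one_le_iff_ne_zero.1 (Finset.mem_Icc.1 k.2).1)]
  exact hermitePeak_pos _

theorem minimaxPeak_le {k₀ k : ℕ} (hk : 1 ≤ k) (hkk : k ≤ k₀) :
    minimaxPeak k₀ ≤ hermitePeak k := by
  rw [← iSup_norm_gabor_hermiteDist (Nat.one_le_iff_ne_zero.1 hk)]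
  exact ciInf_le (f := fun k : Finset.Icc 1 k₀ => ⨆ p : ℝ × ℝ, ‖gabor (hermiteDist k) p.1 p.2‖)
    (Set.finite_range _).bddBelow ⟨k, Finset.mem_Icc.2 ⟨hk, hkk⟩⟩

/-- The fraction in `modeConst` contributes exactly 2 to the product, and the added 1 makes both
inequalities strict. -/
theorem one_lt_modeConst_and_two_lt {k₀ k : ℕ} (hk : 1 ≤ k) (hkk : k ≤ k₀) :
    1 < modeConst k₀ ∧ 2 < (1 - beta k) * (5 * modeConst k₀) := by
  have : Nonempty (Finset.Icc 1 k₀) := ⟨⟨k, Finset.mem_Icc.2 ⟨hk, hkk⟩⟩⟩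
  obtain ⟨j, hj⟩ := exists_eq_ciSup_of_finite (f := fun k : Finset.Icc 1 k₀ => beta k)
  have h1 : ⨆ k : Finset.Icc 1 k₀, beta k < 1 := by
    rw [← hj]
    exact beta_lt_one (Nat.one_le_iff_ne_zero.1 (Finset.mem_Icc.1 j.2).1)
  have h2 : beta k ≤ ⨆ k : Finset.Icc 1 k₀, beta k :=
    le_ciSup (f := fun k : Finset.Icc 1 k₀ => beta k) (Set.finite_range _).bddAbove
      ⟨k, Finset.mem_Icc.2 ⟨hk, hkk⟩⟩
  rw [modeConst]
  set B := ⨆ k : Finset.Icc 1 k₀, beta k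
  have h3 : 0 < 1 - B := by linarith
  refine ⟨by have : 0 < 2 / (5 * (1 - B)) := by positivity
             linarith, ?_⟩
  have h4 : (1 - B) * (5 * (2 / (5 * (1 - B)) + 1)) = 2 + 5 * (1 - B) := by
    field_simp
  have h5 : (1 - B) * (5 * (2 / (5 * (1 - B)) + 1)) ≤
      (1 - beta k) * (5 * (2 / (5 * (1 - B)) + 1)) := by
    gcongr
  linarith

/-- Write `A` for the signal peak. The noise moves the maximum by at most `δη`, and at any maximiser
the signal is at least `A - 2δη ≥ A - 2η`. This exceeds `beta k * A` because `(1 - beta k) A > 2η`,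
so `k̂ = k` and the relative error is at most `δη / A ≤ δ`. -/
theorem abs_lambdaHat_div_sub_one_le {k₀ k : ℕ} (hk : 1 ≤ k) (hkk : k ≤ k₀)
    {δ η L lam σ : ℝ} (hδ0 : 0 < δ) (hδ : δ ≤ 1) (hη : 0 < η) (hL : √((k₀ : ℝ) / Real.pi) < L)
    (hlam : 5 * modeConst k₀ * η ≤ |lam| * hermitePeak k) {T : 𝓢'(ℝ, ℂ)}
    (hT : ∀ p ∈ box L, |σ| * ‖gabor T p.1 p.2‖ ≤ δ * η) :
    |lambdaHat (levelSet L ((lam : ℂ) • hermiteDist k + (σ : ℂ) • T)) / |lam| - 1| ≤ δ := by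
  set y : 𝓢'(ℝ, ℂ) := (lam : ℂ) • hermiteDist k + (σ : ℂ) • T with hy
  have hk0 : k ≠ 0 := Nat.one_le_iff_ne_zero.1 hk
  obtain ⟨hC1, hC2⟩ := one_lt_modeConst_and_two_lt hk hkk
  set C := modeConst k₀
  set A := |lam| * hermitePeak k with hA
  have hMpos := hermitePeak_pos k
  have hδη : δ * η ≤ η := by nlinarith
  have hA0 : 0 < A := by
    have : 0 < 5 * C * η := by positivity
    linarith
  have hlam0 : 0 < |lam| := pos_of_mul_pos_left hA0 hMpos.le
  have hsig : ∀ p : ℝ × ℝ, ‖(lam : ℂ) * gabor (hermiteDist k) p.1 p.2‖ =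
      |lam| * ‖gabor (hermiteDist k) p.1 p.2‖ := fun p => by
    rw [norm_mul, Complex.norm_real, Real.norm_eq_abs]
  have hnoise : ∀ p ∈ box L, ‖(σ : ℂ) * gabor T p.1 p.2‖ ≤ δ * η := fun p hp => by
    rw [norm_mul, Complex.norm_real, Real.norm_eq_abs]
    exact hT p hp
  have hup : ∀ p ∈ box L, ‖gabor y p.1 p.2‖ ≤
      |lam| * ‖gabor (hermiteDist k) p.1 p.2‖ + δ * η := fun p hp => by
    rw [hy, gabor_add_smul, ← hsig]
    exact (norm_add_le _ _).trans (by gcongr; exact hnoise p hp)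
  have hlow : ∀ p ∈ box L, |lam| * ‖gabor (hermiteDist k) p.1 p.2‖ - δ * η ≤
      ‖gabor y p.1 p.2‖ := fun p hp => by
    rw [hy, gabor_add_smul, ← hsig]
    have h1 := hnoise p hp
    have h2 := norm_sub_le_norm_add ((lam : ℂ) * gabor (hermiteDist k) p.1 p.2)
      ((σ : ℂ) * gabor T p.1 p.2)
    linarith
  have hpeak : ((√((k : ℝ) / Real.pi), 0) : ℝ × ℝ) ∈ box L := by
    have h1 : √((k : ℝ) / Real.pi) ≤ √((k₀ : ℝ) / Real.pi) := by gcongr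
    have h2 : 0 ≤ √((k : ℝ) / Real.pi) := Real.sqrt_nonneg _
    change max |√((k : ℝ) / Real.pi)| |(0 : ℝ)| ≤ L
    refine max_le ?_ ?_
    · rw [abs_of_nonneg h2]
      linarith
    · rw [abs_zero]
      linarith
  have hcont : Continuous fun p : ℝ × ℝ => ‖gabor y p.1 p.2‖ := (continuous_gabor y).norm
  obtain ⟨p, hp, hmax⟩ := (isCompact_box L).exists_isMaxOn ⟨_, hpeak⟩ hcont.continuousOn
  have hθ := thetaHat_levelSet hp fun q hq => hmax hq
  set θ := thetaHat (levelSet L y) with hθdef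
  have hθup : θ ≤ A + δ * η := by
    rw [hθ]
    refine (hup p hp).trans ?_
    have := norm_gabor_hermiteDist_le hk0 p.1 p.2
    rw [hA]
    gcongr
  have hθlow : A - δ * η ≤ θ := by
    have h1 := hlow _ hpeak
    rw [norm_gabor_hermiteDist_peak] at h1
    rw [hθ]
    exact h1.trans (hmax hpeak)
  have hkhat : kHat (levelSet L y) = k := by
    refine kHat_eq ⟨p, hp, hθ.le⟩ (fun q ⟨hq, hqθ⟩ => abs_sub_lt_half_of_beta_mul_lt hk0 ?_) ?_
    · have h1 := hup q hq
      have h2 : (1 - beta k) * (5 * C) * η ≤ (1 - beta k) * A := by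
        rw [mul_assoc]
        exact mul_le_mul_of_nonneg_left hlam (by linarith [beta_lt_one hk0])
      have h3 : 2 * η < (1 - beta k) * (5 * C) * η := by gcongr
      have h4 : |lam| * (beta k * hermitePeak k) < |lam| * ‖gabor (hermiteDist k) q.1 q.2‖ := by
        have : |lam| * (beta k * hermitePeak k) = beta k * A := by
          rw [hA]
          ring
        linarith
      exact lt_of_mul_lt_mul_left h4 hlam0.le
    · exact (isCompact_box L).inter_right (isClosed_le continuous_const hcont)
  have hlamHat : lambdaHat (levelSet L y) = θ / hermitePeak k := by
    rw [lambdaHat, hkhat, hermitePeak]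
  have hfin : θ / hermitePeak k / |lam| - 1 = (θ - A) / A := by
    rw [hA]
    field_simp
  rw [hlamHat, hfin, abs_div, abs_of_pos hA0, div_le_iff₀ hA0]
  have hηA : η ≤ A := by nlinarith
  calc |θ - A| ≤ δ * η := abs_le.2 ⟨by linarith, by linarith⟩
    _ ≤ δ * A := by gcongr

end Gabor

end

/-! ### Combining the noise bound with the deterministic estimate -/

theorem theorem5 :
    ∃ K : ℝ, 0 < K ∧
      ∀ (Ω : Type*) [MeasurableSpace Ω] (P : Measure Ω) [IsProbabilityMeasure P]
        (ξ : Ω → 𝓢'(ℝ, ℂ)), Gabor.IsWhiteNoise P ξ →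
        -- the noise bound that fixes the meaning of `K`
        (∀ L τ : ℝ, Real.pi ≤ L → 0 < τ →
          1 - 4 * Real.exp (-(τ ^ 2 / (2 * Real.pi) * Real.log L)) ≤
            P.real {ω | ∀ p ∈ Gabor.box L,
              √Real.pi * ‖Gabor.gabor (ξ ω) p.1 p.2‖ ≤ √2 * (14 * K + τ) * √(Real.log L)}) ∧
        -- estimation of the signal strength, for every noise amplitude `0 < σ ≤ √π`
        ∀ (k₀ : ℕ) (δ L lam σ : ℝ), 0 < δ → δ ≤ 1 → 0 < σ → σ ≤ √Real.pi →
          max (max √((k₀ : ℝ) / Real.pi) Real.pi) (Real.exp ((14 * K / δ) ^ 2)) < L →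
          5 * Gabor.modeConst k₀ * √2 * (Gabor.minimaxPeak k₀)⁻¹ * Real.log L ≤ |lam| →
          ∀ k : ℕ, 1 ≤ k → k ≤ k₀ →
            1 - 4 * Real.exp (-(δ ^ 2 * Real.log L ^ 2 / (2 * Real.pi) *
                (1 - 14 * K / (δ * √(Real.log L))) ^ 2)) ≤
              P.real {ω | |Gabor.lambdaHat (Gabor.levelSet L
                ((lam : ℂ) • Gabor.hermiteDist k + (σ : ℂ) • ξ ω)) / |lam| - 1| ≤ δ} := by
  refine ⟨1, one_pos, fun Ω _ P _ ξ hξ => ⟨fun L τ hL hτ => ?_, ?_⟩⟩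
  · simpa using hξ.prob_sup_gabor_le hL hτ
  intro k₀ δ L lam σ hδ0 hδ hσ0 hσ hL hlam k hk hkk
  obtain ⟨hL12, hL3⟩ := max_lt_iff.1 hL
  obtain ⟨hL1, hL2⟩ := max_lt_iff.1 hL12
  have hL0 : 0 < L := Real.pi_pos.trans hL2
  have hlog : (14 * 1 / δ) ^ 2 < Real.log L := (Real.lt_log_iff_exp_lt hL0).2 hL3
  have hlog0 : 0 < Real.log L := (sq_nonneg _).trans_lt hlog
  set s := √(Real.log L) with hs
  have hs0 : 0 < s := Real.sqrt_pos.2 hlog0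
  have hss : s ^ 2 = Real.log L := Real.sq_sqrt hlog0.le
  -- This `τ` makes the noise level `√2 (14 + τ) s` equal to `δ √2 log L`, that is `δη` with `η = √2
  -- log L`. The lower bound on `L` is what makes it positive.
  have hτ : 0 < δ * s - 14 := by
    have h1 : 14 * 1 / δ < s := (Real.lt_sqrt (by positivity)).2 hlog
    rw [div_lt_iff₀ hδ0] at h1
    linarith
  have hmain := hξ.prob_sup_gabor_le hL2.le hτ
  have hexp : (δ * s - 14) ^ 2 / (2 * Real.pi) * Real.log L =
      δ ^ 2 * Real.log L ^ 2 / (2 * Real.pi) * (1 - 14 * 1 / (δ * s)) ^ 2 := by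
    rw [← hss]
    field_simp
  rw [hexp] at hmain
  refine hmain.trans (measureReal_mono fun ω hω => ?_)
  have hη : 0 < √2 * Real.log L := by positivity
  have hm := Gabor.minimaxPeak_pos (hk.trans hkk)
  have hC := (Gabor.one_lt_modeConst_and_two_lt hk hkk).1
  refine Gabor.abs_lambdaHat_div_sub_one_le hk hkk hδ0 hδ hη hL1 ?_ fun p hp => ?_
  · calc 5 * Gabor.modeConst k₀ * (√2 * Real.log L)
        = 5 * Gabor.modeConst k₀ * √2 * (Gabor.minimaxPeak k₀)⁻¹ * Real.log L *
          Gabor.minimaxPeak k₀ := by field_simp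
      _ ≤ |lam| * Gabor.hermitePeak k :=
        mul_le_mul hlam (Gabor.minimaxPeak_le hk hkk) hm.le (abs_nonneg _)
  · rw [abs_of_pos hσ0]
    calc σ * ‖Gabor.gabor (ξ ω) p.1 p.2‖ ≤ √Real.pi * ‖Gabor.gabor (ξ ω) p.1 p.2‖ := by gcongr
      _ ≤ √2 * (14 + (δ * s - 14)) * s := hω p hp
      _ = δ * (√2 * Real.log L) := by
        rw [← hss]
        ring
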